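/- Let $n\ge 1$, $R\in(0,+\infty]$, and let $\xi\in C^\infty([0,R))$ satisfy $\xi>0$ on $(0,R)$, $\xi^{(2k)}(0)=0$ for all $k\ge 0$, and $\xi'(0)=1$. Let $P=[0,R)\times_\xi\mathbb{S}^{n-1}$ be the $n$-dimensional model manifold with pole $o$ and metric $g_P=dr^2+\xi(r)^2\,d\theta^2$. Let $c>0$ be a constant and define $\psi:[0,R)\to\mathbb{R}$ by $$e^{\psi(r)}=c\cdot\begin{cases}\left(\dfrac{\xi(r)}{r}\right)^{n-1}, & r\neq 0,\\ 1, & r=0,\end{cases}$$ that is, $\psi(r)=\log c+(n-1)\log\frac{\xi(r)}{r}$ for $r\ne0$ and $\psi(0)=\log c$. Let $M=P\times_{e^{-\psi}}\mathbb{R}$ be the warped product with metric $e^{-2\psi(r)}ds^2+g_P$, with Killing field $Y=\partial_s$. Fix $0<r_0<R$, let $H_0=-1/r_0$, and define $$u(r)=\int_{r_0}^{r}\frac{H_0\,\tau}{\sqrt{1-H_0^2\tau^2}}\,e^{\psi(\tau)}\,d\tau ,\qquad r\in[0,r_0].$$ Then $\psi$, viewed as the radial function $x\mapsto\psi(r(x))$,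 is smooth on $P$, the metric of $M$ is a smooth Riemannian metric, and the integral defining $u$ converges absolutely. The function $u$ is smooth on $\Omega=B^P_{r_0}(o)=\{r<r_0\}$, and its Killing graph $\{(x,u(r(x))):x\in\Omega\}\subset M$ has constant mean curvature $H_0$ with respect to its upward pointing unit normal $\mathcal N$ (the one with $\langle\mathcal N,Y\rangle>0$), where the mean curvature is $\frac1n$ times the trace of the second fundamental form $(v,w)\mapsto\langle\nabla^M_v w,\mathcal N\rangle$. Moreover, for all $r\in[0,r_0]$, $$0\le e^{-\psi(r)}u(r)\le\frac{\max_{[0,r_0]}e^{-\psi}}{\min_{[0,r_0]}e^{-\psi}}\cdot\frac1{|H_0|}=e^{\sup_\Omega\psi-\inf_\Omega\psi}\,\frac1{|H_0|}.$$ -/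

import Mathlib

open Set
open scoped ContDiff

noncomputable section

namespace KillingGraph

/-- The half-open interval `[0, R)` with `R ∈ (0, +∞]`. -/
def radii (R : EReal) : Set ℝ := {r | 0 ≤ r ∧ (r : EReal) < R}

/-- `ξ ∈ C^∞([0, R))` is the warping function of a model manifold: it is positive on `(0, R)`, all
its derivatives of even order (order `0` included) vanish at `0`, and `ξ'(0) = 1`. -/
structure IsModelWarping (R : EReal) (ξ : ℝ → ℝ) : Prop where
  smooth : ContDiffOn ℝ ∞ ξ (radii R)
  pos : ∀ r : ℝ, 0 < r → (r : EReal) < R → 0 < ξ r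
  even_deriv : ∀ k : ℕ, iteratedDerivWithin (2 * k) ξ (radii R) 0 = 0
  deriv_one : derivWithin ξ (radii R) 0 = 1

/-- The underlying space of the `n`-dimensional model manifold `P = [0, R) ×_ξ 𝕊ⁿ⁻¹`: the point
with Gaussian coordinates `(r, θ)` is `r θ`, so that `‖x‖ = r` and the pole is `0`. -/
def modelSpace (n : ℕ) (R : EReal) : Set (EuclideanSpace ℝ (Fin n)) := {x | ((‖x‖ : ℝ) : EReal) < R}

/-- The differential `dr` of `r = ‖x‖` at `x ≠ 0`. -/
def dr {n : ℕ} (x : EuclideanSpace ℝ (Fin n)) : EuclideanSpace ℝ (Fin n) →L[ℝ] ℝ :=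
  ‖x‖⁻¹ • innerSL ℝ x

/-- The symmetric form `α ⊗ α`. -/
def tensorSq {E : Type*} [NormedAddCommGroup E] [NormedSpace ℝ E] (α : E →L[ℝ] ℝ) :
    E →L[ℝ] E →L[ℝ] ℝ :=
  α.smulRight α

/-- The Euclidean metric. -/
def euclid (n : ℕ) : EuclideanSpace ℝ (Fin n) →L[ℝ] EuclideanSpace ℝ (Fin n) →L[ℝ] ℝ :=
  innerSL ℝ

/-- The form `dθ²` at `x ≠ 0`, that is, the pullback of the round metric of the unit sphere under
`x ↦ x / ‖x‖`; the Euclidean metric is `dr² + r² dθ²`. -/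
def dthetaSq {n : ℕ} (x : EuclideanSpace ℝ (Fin n)) :
    EuclideanSpace ℝ (Fin n) →L[ℝ] EuclideanSpace ℝ (Fin n) →L[ℝ] ℝ :=
  (‖x‖ ^ 2)⁻¹ • (euclid n - tensorSq (dr x))

open scoped Classical in
/-- The model metric `g_P = dr² + ξ(r)² dθ²` in Cartesian coordinates, with its value at the pole
(the Euclidean inner product, as `ξ'(0) = 1`). -/
def modelMetric {n : ℕ} (ξ : ℝ → ℝ) (x : EuclideanSpace ℝ (Fin n)) :
    EuclideanSpace ℝ (Fin n) →L[ℝ] EuclideanSpace ℝ (Fin n) →L[ℝ] ℝ :=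
  if x = 0 then euclid n else tensorSq (dr x) + (ξ ‖x‖) ^ 2 • dthetaSq x

/-- The metric `e^{-2ψ(r)} ds² + g_P` of the warped product `M = P ×_{e^{-ψ}} ℝ`, at `(x, s)`. -/
def warpedMetric {n : ℕ} (ξ ψ : ℝ → ℝ) (p : EuclideanSpace ℝ (Fin n) × ℝ) :
    (EuclideanSpace ℝ (Fin n) × ℝ) →L[ℝ] (EuclideanSpace ℝ (Fin n) × ℝ) →L[ℝ] ℝ :=
  Real.exp (-2 * ψ ‖p.1‖) • tensorSq (ContinuousLinearMap.snd ℝ (EuclideanSpace ℝ (Fin n)) ℝ) +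
    (modelMetric ξ p.1).bilinearComp (ContinuousLinearMap.fst ℝ (EuclideanSpace ℝ (Fin n)) ℝ)
      (ContinuousLinearMap.fst ℝ (EuclideanSpace ℝ (Fin n)) ℝ)

/-- `g` is a smooth Riemannian metric on the open subset `U` of a normed space. -/
structure IsRiemannianMetricOn {E : Type*} [NormedAddCommGroup E] [NormedSpace ℝ E]
    (g : E → E →L[ℝ] E →L[ℝ] ℝ) (U : Set E) : Prop where
  smooth : ContDiffOn ℝ ∞ g U
  symm : ∀ p ∈ U, ∀ X Y : E, g p X Y = g p Y X
  pos : ∀ p ∈ U, ∀ X : E, X ≠ 0 → 0 < g p X X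

/-- Christoffel symbols of the first kind: `⟨∇_X Y, Z⟩` for constant vector fields `X, Y, Z`, where
`∇` is the Levi-Civita connection of `g` (Koszul's formula). -/
def christoffel {E : Type*} [NormedAddCommGroup E] [NormedSpace ℝ E]
    (g : E → E →L[ℝ] E →L[ℝ] ℝ) (p X Y Z : E) : ℝ :=
  (fderiv ℝ g p X Y Z + fderiv ℝ g p Y X Z - fderiv ℝ g p Z X Y) / 2

/-- The parametrization `x ↦ (x, u(x))` of the Killing graph of `u`: the point `x ∈ P` is moved for
the time `u(x)` along the flow of the Killing field `Y = ∂_s`. -/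
def graphMap {n : ℕ} (u : EuclideanSpace ℝ (Fin n) → ℝ) (x : EuclideanSpace ℝ (Fin n)) :
    EuclideanSpace ℝ (Fin n) × ℝ :=
  (x, u x)

/-- `N` is the upward pointing unit normal at `F(x) = (x, u(x))` of the graph of `u`: it is
orthogonal to the graph, of length one, and `⟨N, Y⟩ > 0` for `Y = ∂_s`. -/
structure IsUpwardUnitNormal {n : ℕ}
    (g : EuclideanSpace ℝ (Fin n) × ℝ →
      (EuclideanSpace ℝ (Fin n) × ℝ) →L[ℝ] (EuclideanSpace ℝ (Fin n) × ℝ) →L[ℝ] ℝ)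
    (u : EuclideanSpace ℝ (Fin n) → ℝ) (x : EuclideanSpace ℝ (Fin n))
    (N : EuclideanSpace ℝ (Fin n) × ℝ) : Prop where
  normal : ∀ v : EuclideanSpace ℝ (Fin n), g (graphMap u x) N (fderiv ℝ (graphMap u) x v) = 0
  unit : g (graphMap u x) N N = 1
  upward : 0 < g (graphMap u x) N (0, 1)

/-- The metric induced on the graph of `u`, as a form on the parameter domain. -/
def firstFundamentalForm {n : ℕ}
    (g : EuclideanSpace ℝ (Fin n) × ℝ →
      (EuclideanSpace ℝ (Fin n) × ℝ) →L[ℝ] (EuclideanSpace ℝ (Fin n) × ℝ) →L[ℝ] ℝ)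
    (u : EuclideanSpace ℝ (Fin n) → ℝ) (x v w : EuclideanSpace ℝ (Fin n)) : ℝ :=
  g (graphMap u x) (fderiv ℝ (graphMap u) x v) (fderiv ℝ (graphMap u) x w)

/-- The second fundamental form `⟨∇_v w, N⟩` of the graph of `u` in direction `N`, for `∇` the
Levi-Civita connection of the ambient metric. -/
def secondFundamentalForm {n : ℕ}
    (g : EuclideanSpace ℝ (Fin n) × ℝ →
      (EuclideanSpace ℝ (Fin n) × ℝ) →L[ℝ] (EuclideanSpace ℝ (Fin n) × ℝ) →L[ℝ] ℝ)
    (u : EuclideanSpace ℝ (Fin n) → ℝ) (N : EuclideanSpace ℝ (Fin n) × ℝ)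
    (x v w : EuclideanSpace ℝ (Fin n)) : ℝ :=
  g (graphMap u x) (fderiv ℝ (fderiv ℝ (graphMap u)) x v w) N +
    christoffel g (graphMap u x) (fderiv ℝ (graphMap u) x v) (fderiv ℝ (graphMap u) x w) N

/-- The matrix of a bilinear function in the standard basis of `ℝⁿ`. -/
def gram {n : ℕ} (b : EuclideanSpace ℝ (Fin n) → EuclideanSpace ℝ (Fin n) → ℝ) :
    Matrix (Fin n) (Fin n) ℝ :=
  Matrix.of fun i j => b (EuclideanSpace.single i 1) (EuclideanSpace.single j 1)

/-- The mean curvature with respect to the normal `N`: `1/n` times the trace of the second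
fundamental form with respect to the induced metric. -/
def meanCurvature {n : ℕ}
    (g : EuclideanSpace ℝ (Fin n) × ℝ →
      (EuclideanSpace ℝ (Fin n) × ℝ) →L[ℝ] (EuclideanSpace ℝ (Fin n) × ℝ) →L[ℝ] ℝ)
    (u : EuclideanSpace ℝ (Fin n) → ℝ) (N : EuclideanSpace ℝ (Fin n) × ℝ)
    (x : EuclideanSpace ℝ (Fin n)) : ℝ :=
  (1 / (n : ℝ)) *
    ((gram (firstFundamentalForm g u x))⁻¹ * gram (secondFundamentalForm g u N x)).trace

/-- The graph of the (smooth) function `u` over `Ω` has constant mean curvature `H` with respect to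
its upward pointing Gauss map. -/
structure IsCMCGraph {n : ℕ}
    (g : EuclideanSpace ℝ (Fin n) × ℝ →
      (EuclideanSpace ℝ (Fin n) × ℝ) →L[ℝ] (EuclideanSpace ℝ (Fin n) × ℝ) →L[ℝ] ℝ)
    (u : EuclideanSpace ℝ (Fin n) → ℝ) (Ω : Set (EuclideanSpace ℝ (Fin n))) (H : ℝ) : Prop where
  smooth : ContDiffOn ℝ ∞ u Ω
  exists_normal : ∀ x ∈ Ω, ∃ N, IsUpwardUnitNormal g u x N
  meanCurvature_eq : ∀ x ∈ Ω, ∀ N, IsUpwardUnitNormal g u x N → meanCurvature g u N x = H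

open scoped Classical in
/-- The function `ψ` with `e^ψ = c (ξ(r)/r)^{n-1}` for `r ≠ 0` and `e^{ψ(0)} = c`. -/
def psi (n : ℕ) (c : ℝ) (ξ : ℝ → ℝ) (r : ℝ) : ℝ :=
  Real.log c + if r = 0 then 0 else ((n : ℝ) - 1) * Real.log (ξ r / r)

/-- The integrand `H₀ τ e^{ψ(τ)} / √(1 - H₀² τ²)` of the profile. -/
def profileDensity (ψ : ℝ → ℝ) (H₀ τ : ℝ) : ℝ :=
  H₀ * τ / Real.sqrt (1 - H₀ ^ 2 * τ ^ 2) * Real.exp (ψ τ)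

/-- The profile `u(r) = ∫_{r₀}^r H₀ τ e^{ψ(τ)} / √(1 - H₀² τ²) dτ`. -/
def profile (ψ : ℝ → ℝ) (H₀ r₀ r : ℝ) : ℝ :=
  ∫ τ in r₀..r, profileDensity ψ H₀ τ

end KillingGraph

end

namespace KillingGraph

open Filter Topology MeasureTheory

/-! The choice of `ψ` makes the weight `e^{-ψ} ξ^{n-1}` equal to `r^{n-1}/c`, as in flat space. A
radial Killing graph has mean curvature `H` when `(ξ^{n-1} e^{-ψ} · e^{-ψ}u'/√(1 + e^{-2ψ}u'²))' = n
H ξ^{n-1} e^{-ψ}`. The profile is chosen so that `e^{-ψ}u'/√(1 + e^{-2ψ}u'²) = H₀ r`, and the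
equation becomes `(H₀ r^n)' = n H₀ r^{n-1}`: the graph is modelled on a Euclidean hemisphere of
radius `r₀`.

To treat the pole like any other point, everything is written with smooth even functions of `‖x‖`.
On `[0, a]` one has `ξ = r q` and `1 - q² = r² p` with `q`, `p` even
(`IsModelWarping.exists_evenData`), so that `g_P = q² ⟨·,·⟩ + p ⟨x,·⟩²` and `ψ = log c + (n-1) log
q`. Such functions are smooth on `ℝⁿ` (`contDiff_comp_norm_of_even`), and their gradients are again
such functions times `x`.

The mean curvature is computed directly from Christoffel symbols. The normal is `(-H₀ x, H₀/(e κ))`,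
with `e = e^{-2ψ}` and `κ = u'/r` (`isUpwardUnitNormal_radialForm_iff`). Both fundamental forms are
combinations of `⟨v,w⟩` and `⟨x,v⟩⟨x,w⟩`; with `ψ' = r ψ₁`, the tangential directions contribute
`H₀(n - 1 + ψ₁ r²)` to the trace and the radial one `H₀(1 - ψ₁ r²)`, in total `n H₀`
(`meanCurvature_radialForm`).

For the height, bounding `e^ψ` by its maximum leaves the explicit hemisphere integral `r₀ √(1 - H₀²
r²) ≤ r₀ = 1/|H₀|` (`profile_nonneg_and_le`). -/

/-! ### Division of smooth odd and even functions by powers of `r`. -/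

theorem hasDerivAt_integral_pow_mul_comp_mul {φ : ℝ → ℝ} (hφ : ContDiff ℝ 1 φ) (j : ℕ) (r : ℝ) :
    HasDerivAt (fun r => ∫ t in (0 : ℝ)..1, t ^ j * φ (t * r))
      (∫ t in (0 : ℝ)..1, t ^ (j + 1) * deriv φ (t * r)) r := by
  have hd : Continuous (deriv φ) := hφ.continuous_deriv le_rfl
  -- This interval contains every `t x` with `t ∈ [0,1]` and `|x - r| < 1`, so `C` dominates the
  -- derivative of the integrand near `r`.
  obtain ⟨C, hC⟩ := (isCompact_Icc (a := -(|r| + 1)) (b := |r| + 1)).exists_bound_of_continuousOn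
    hd.continuousOn
  refine (intervalIntegral.hasDerivAt_integral_of_dominated_loc_of_deriv_le
    (F := fun r t => t ^ j * φ (t * r)) (F' := fun r t => t ^ (j + 1) * deriv φ (t * r))
    (bound := fun _ => C) (Metric.ball_mem_nhds r one_pos) ?_ ?_ ?_ ?_ ?_ ?_).2
  · refine Eventually.of_forall fun x => Continuous.aestronglyMeasurable ?_
    have := hφ.continuous
    fun_prop
  · refine Continuous.intervalIntegrable ?_ _ _
    have := hφ.continuous
    fun_prop
  · refine Continuous.aestronglyMeasurable ?_
    fun_prop
  · refine Eventually.of_forall fun t ht x hx => ?_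
    rw [uIoc_of_le zero_le_one] at ht
    have hx' : |x| ≤ |r| + 1 := by
      have h1 : |x - r| < 1 := by simpa [Real.dist_eq] using hx
      have h2 := abs_sub_abs_le_abs_sub x r
      linarith
    have htx : |t * x| ≤ |r| + 1 := by
      rw [abs_mul, abs_of_pos ht.1]
      exact (mul_le_of_le_one_left (abs_nonneg x) ht.2).trans hx'
    have hb := hC (t * x) (abs_le.1 htx)
    rw [norm_mul, norm_pow, Real.norm_of_nonneg ht.1.le]
    exact (mul_le_of_le_one_left (norm_nonneg _) (pow_le_one₀ ht.1.le ht.2)).trans hb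
  · exact intervalIntegrable_const
  · refine Eventually.of_forall fun t _ x _ => ?_
    have h1 : HasDerivAt (fun x => t * x) t x := by
      simpa using (hasDerivAt_id x).const_mul t
    have h2 := ((hφ.differentiable (by norm_num) (t * x)).hasDerivAt.comp x h1).const_mul (t ^ j)
    refine h2.congr_deriv ?_
    ring

/-- The factor `t ^ j` makes the family closed under differentiation: `(φ, j)` becomes `(φ', j +
1)`, so induction on the order applies. -/
theorem contDiff_integral_pow_mul_comp_mul {φ : ℝ → ℝ} (hφ : ContDiff ℝ ∞ φ) (j : ℕ) :
    ContDiff ℝ ∞ (fun r => ∫ t in (0 : ℝ)..1, t ^ j * φ (t * r)) := by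
  refine contDiff_infty.2 fun k => ?_
  induction k generalizing φ j with
  | zero =>
    refine contDiff_zero.2 (continuous_iff_continuousAt.2 fun r => ?_)
    exact (hasDerivAt_integral_pow_mul_comp_mul (hφ.of_le (mod_cast le_top)) j r).continuousAt
  | succ k ih =>
    have h := hasDerivAt_integral_pow_mul_comp_mul (hφ.of_le (mod_cast le_top)) j
    rw [show ((k + 1 : ℕ) : ℕ∞ω) = (k : ℕ∞ω) + 1 by push_cast; rfl, contDiff_succ_iff_deriv]
    refine ⟨fun r => (h r).differentiableAt, by simp, ?_⟩
    rw [funext fun r => (h r).deriv]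
    exact ih (contDiff_infty_iff_deriv.1 hφ).2 (j + 1)

/-- A smooth odd function is the product of the identity and a smooth even function. -/
theorem exists_even_contDiff_eq_mul {f : ℝ → ℝ} (hf : ContDiff ℝ ∞ f)
    (hodd : ∀ r, f (-r) = -f r) :
    ∃ g : ℝ → ℝ, ContDiff ℝ ∞ g ∧ (∀ r, g (-r) = g r) ∧ ∀ r, f r = r * g r := by
  have hf' := contDiff_infty_iff_deriv.1 hf
  have hmul : ∀ r, f r = r * ∫ t in (0 : ℝ)..1, t ^ 0 * deriv f (t * r) := by
    intro r
    have h0 : f 0 = 0 := by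
      have := hodd 0
      rw [neg_zero] at this
      linarith
    have hd : ∀ t ∈ uIcc (0 : ℝ) 1, HasDerivAt (fun t => f (t * r)) (deriv f (t * r) * r) t := by
      intro t _
      have h1 : HasDerivAt (fun t => t * r) r t := by
        simpa using (hasDerivAt_id t).mul_const r
      exact (hf'.1 (t * r)).hasDerivAt.comp t h1
    have hc : Continuous fun t => deriv f (t * r) * r := by
      have := hf'.2.continuous
      fun_prop
    have := intervalIntegral.integral_eq_sub_of_hasDerivAt hd (hc.intervalIntegrable _ _)
    simp only [one_mul, zero_mul, h0, sub_zero, intervalIntegral.integral_mul_const] at this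
    simp only [pow_zero, one_mul]
    rw [mul_comm, this]
  refine ⟨_, contDiff_integral_pow_mul_comp_mul hf'.2 0, fun r => ?_, hmul⟩
  rcases eq_or_ne r 0 with rfl | hr
  · rw [neg_zero]
  · refine mul_left_cancel₀ hr ?_
    have h1 := hmul r
    have h2 := hmul (-r)
    rw [hodd] at h2
    linarith

theorem deriv_odd_of_even {f : ℝ → ℝ} (heven : ∀ r, f (-r) = f r) (r : ℝ) :
    deriv f (-r) = -deriv f r := by
  have h := deriv_comp_neg f r
  rw [show (fun x => f (-x)) = f from funext heven] at h
  linarith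

theorem exists_deriv_eq_mul_of_even {f : ℝ → ℝ} (hf : ContDiff ℝ ∞ f)
    (heven : ∀ r, f (-r) = f r) :
    ∃ g : ℝ → ℝ, ContDiff ℝ ∞ g ∧ (∀ r, g (-r) = g r) ∧ ∀ r, HasDerivAt f (r * g r) r := by
  have hf' := contDiff_infty_iff_deriv.1 hf
  obtain ⟨g, hg, hge, h⟩ := exists_even_contDiff_eq_mul hf'.2 (deriv_odd_of_even heven)
  exact ⟨g, hg, hge, fun r => h r ▸ (hf'.1 r).hasDerivAt⟩

/-! ### Radial functions on an inner product space. -/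

section Radial

variable {E : Type*} [NormedAddCommGroup E] [InnerProductSpace ℝ E]

/-- Writing the derivative as `‖x‖ * g` absorbs the denominator of `d‖x‖ = ⟨x,·⟩/‖x‖`, which gives
one formula valid at the origin too. -/
theorem hasFDerivAt_comp_norm {f : ℝ → ℝ} {g : ℝ} {x : E} (h : HasDerivAt f (‖x‖ * g) ‖x‖) :
    HasFDerivAt (fun y : E => f ‖y‖) (g • innerSL ℝ x) x := by
  -- At the origin the hypothesis says `f'(0) = 0`, so the remainder is `o(‖y‖)` although the norm
  -- is not differentiable there.
  rcases eq_or_ne x 0 with rfl | hx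
  · simp only [norm_zero, zero_mul] at h
    have h1 := h.isLittleO
    simp only [sub_zero, smul_zero] at h1
    refine HasFDerivAt.of_isLittleO ?_
    simp only [sub_zero, norm_zero, map_zero, smul_zero, zero_apply]
    exact Asymptotics.isLittleO_norm_right.1 (h1.comp_tendsto (tendsto_norm_zero (E := E)))
  · have hn : ‖x‖ ≠ 0 := norm_ne_zero_iff.2 hx
    have hsq : HasFDerivAt (fun y : E => ‖y‖) (‖x‖⁻¹ • innerSL ℝ x) x := by
      have h1 := (hasStrictFDerivAt_norm_sq x).hasFDerivAt.sqrt (by positivity)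
      simp only [Real.sqrt_sq (norm_nonneg _)] at h1
      convert h1 using 1
      ext y
      simp
      field_simp
    have h2 := h.comp_hasFDerivAt x hsq
    rw [smul_smul, mul_right_comm, mul_inv_cancel₀ hn, one_mul] at h2
    exact h2

/-- A smooth even function of the norm is smooth. -/
theorem contDiff_comp_norm_of_even {f : ℝ → ℝ} (hf : ContDiff ℝ ∞ f) (heven : ∀ r, f (-r) = f r) :
    ContDiff ℝ ∞ (fun x : E => f ‖x‖) := by
  refine contDiff_infty.2 fun k => ?_
  induction k generalizing f with
  | zero => exact contDiff_zero.2 (hf.continuous.comp continuous_norm)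
  | succ k ih =>
    obtain ⟨g, hg, hge, h⟩ := exists_deriv_eq_mul_of_even hf heven
    have hd := fun x : E => hasFDerivAt_comp_norm (h ‖x‖)
    rw [show ((k + 1 : ℕ) : ℕ∞ω) = (k : ℕ∞ω) + 1 by push_cast; rfl, contDiff_succ_iff_fderiv]
    refine ⟨fun x => (hd x).differentiableAt, by simp, ?_⟩
    rw [funext fun x => (hd x).fderiv]
    -- The gradient is `g(‖x‖) x` with `g` smooth and even, so the induction hypothesis applies to
    -- `g`.
    exact (ih hg hge).smul (innerSL ℝ).contDiff

end Radial

/-! ### Extension of the warping function across the pole. -/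

open scoped Classical in
/-- The extension of a function on the nonnegative half-line by `f (-r) = ε f(r)`. -/
noncomputable def reflect (ε : ℝ) (f : ℝ → ℝ) (r : ℝ) : ℝ := if 0 ≤ r then f r else ε * f (-r)

theorem isOpen_setOf_abs_lt (R : EReal) : IsOpen {r : ℝ | ((|r| : ℝ) : EReal) < R} :=
  isOpen_lt (continuous_coe_real_ereal.comp continuous_abs) continuous_const

theorem radii_eq_inter (R : EReal) : radii R = Ici 0 ∩ {r : ℝ | ((|r| : ℝ) : EReal) < R} := by
  ext r
  simp only [radii, mem_ofPred_eq, mem_inter_iff, mem_Ici]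
  exact and_congr_right fun h => by rw [abs_of_nonneg h]

theorem uniqueDiffOn_radii (R : EReal) : UniqueDiffOn ℝ (radii R) := by
  rw [radii_eq_inter]
  exact (uniqueDiffOn_Ici 0).inter (isOpen_setOf_abs_lt R)

theorem hasDerivWithinAt_Ici_of_radii {R : EReal} {f : ℝ → ℝ}
    (hf : DifferentiableOn ℝ f (radii R)) {r : ℝ} (hr : r ∈ radii R) :
    HasDerivWithinAt f (derivWithin f (radii R) r) (Ici 0) r := by
  have h := (hf r hr).hasDerivWithinAt
  refine h.mono_of_mem_nhdsWithin ?_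
  rw [radii_eq_inter] at hr ⊢
  exact inter_mem_nhdsWithin _ ((isOpen_setOf_abs_lt R).mem_nhds hr.2)

/-- The one-sided derivatives at `0` are `f'(0)` and `-ε f'(0)`; `h0` and `h1` say that values and
slopes match. Differentiation reverses the parity, so `ε` turns into `-ε`. -/
theorem hasDerivAt_reflect {R : EReal} {f : ℝ → ℝ} (hf : DifferentiableOn ℝ f (radii R))
    {ε : ℝ} (h0 : f 0 = ε * f 0)
    (h1 : derivWithin f (radii R) 0 = -ε * derivWithin f (radii R) 0) {r : ℝ}
    (hr : ((|r| : ℝ) : EReal) < R) :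
    HasDerivAt (reflect ε f) (reflect (-ε) (derivWithin f (radii R)) r) r := by
  have key : ∀ s ∈ radii R, HasDerivWithinAt (reflect ε f) (derivWithin f (radii R) s) (Ici 0) s :=
    fun s hs => (hasDerivWithinAt_Ici_of_radii hf hs).congr (fun x hx => if_pos hx) (if_pos hs.1)
  have key' : ∀ s, -s ∈ radii R →
      HasDerivWithinAt (reflect ε f) (-ε * derivWithin f (radii R) (-s)) (Iic 0) s := by
    intro s hs
    have h2 := ((hasDerivWithinAt_Ici_of_radii hf hs).comp s (hasDerivAt_neg s).hasDerivWithinAt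
      (s := Iic 0) (fun x hx => by simpa using hx)).const_mul ε
    have heq : ∀ x ∈ Iic (0 : ℝ), reflect ε f x = ε * (f ∘ Neg.neg) x := by
      intro x hx
      rcases (show x ≤ 0 from hx).eq_or_lt with rfl | hx
      · simpa [reflect] using h0
      · simp [reflect, not_le.2 hx]
    refine (h2.congr heq (heq s (by simpa using hs.1))).congr_deriv ?_
    ring
  rcases lt_trichotomy r 0 with h | rfl | h
  · rw [abs_of_neg h] at hr
    have := (key' r ⟨by linarith, hr⟩).hasDerivAt (Iic_mem_nhds h)
    simpa [reflect, not_le.2 h] using this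
  · have hm : (0 : ℝ) ∈ radii R := ⟨le_rfl, by simpa using hr⟩
    have ha := key 0 hm
    have hb := key' 0 (by simpa using hm)
    rw [neg_zero, ← h1] at hb
    have := ha.union hb
    rw [Ici_union_Iic, hasDerivWithinAt_univ] at this
    simpa [reflect] using this
  · rw [abs_of_pos h] at hr
    have := (key r ⟨h.le, hr⟩).hasDerivAt (Ici_mem_nhds h)
    simpa [reflect, h.le] using this

/-- The reflection of a smooth function is smooth if the derivatives match at the origin. -/
theorem contDiffOn_reflect {R : EReal} (hR : 0 < R) {f : ℝ → ℝ} (hf : ContDiffOn ℝ ∞ f (radii R))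
    {ε : ℝ} (h : ∀ j, iteratedDerivWithin j f (radii R) 0 =
      ε * (-1) ^ j * iteratedDerivWithin j f (radii R) 0) :
    ContDiffOn ℝ ∞ (reflect ε f) {r : ℝ | ((|r| : ℝ) : EReal) < R} := by
  have hs := uniqueDiffOn_radii R
  have hm : (0 : ℝ) ∈ radii R := ⟨le_rfl, by simpa using hR⟩
  refine contDiffOn_infty.2 fun k => ?_
  induction k generalizing f ε with
  | zero =>
    refine contDiffOn_zero.2 fun r hr => ContinuousAt.continuousWithinAt ?_
    refine (hasDerivAt_reflect (hf.differentiableOn (by simp)) ?_ ?_ hr).continuousAt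
    · simpa using h 0
    · simpa [iteratedDerivWithin_one] using h 1
  | succ k ih =>
    have hd : ∀ r ∈ {r : ℝ | ((|r| : ℝ) : EReal) < R},
        HasDerivAt (reflect ε f) (reflect (-ε) (derivWithin f (radii R)) r) r := by
      intro r hr
      refine hasDerivAt_reflect (hf.differentiableOn (by simp)) ?_ ?_ hr
      · simpa using h 0
      · simpa [iteratedDerivWithin_one] using h 1
    rw [show ((k + 1 : ℕ) : ℕ∞ω) = (k : ℕ∞ω) + 1 by push_cast; rfl,
      contDiffOn_succ_iff_deriv_of_isOpen (isOpen_setOf_abs_lt R)]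
    refine ⟨fun r hr => (hd r hr).differentiableAt.differentiableWithinAt, by simp, ?_⟩
    refine ContDiffOn.congr (ih (hf.derivWithin hs (by simp)) fun j => ?_)
      fun r hr => (hd r hr).deriv
    have := h (j + 1)
    rw [iteratedDerivWithin_succ'] at this
    rw [pow_succ] at this
    linear_combination this

theorem reflect_neg_one_neg {f : ℝ → ℝ} (h0 : f 0 = 0) (r : ℝ) :
    reflect (-1) f (-r) = -reflect (-1) f r := by
  rcases lt_trichotomy r 0 with h | rfl | h
  · simp [reflect, h.le, not_le.2 h]
  · simp [reflect, h0]
  · simp [reflect, h.le, not_le.2 h]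

/-- The warping function of a model manifold agrees on `[0, a]`, `a < R`, with a smooth odd function
on the whole line. -/
theorem IsModelWarping.exists_odd_extension {R : EReal} {ξ : ℝ → ℝ} (hξ : IsModelWarping R ξ)
    {a : ℝ} (ha : 0 < a) (haR : (a : EReal) < R) :
    ∃ f : ℝ → ℝ, ContDiff ℝ ∞ f ∧ (∀ r, f (-r) = -f r) ∧ ∀ r ∈ Icc 0 a, f r = ξ r := by
  have hR : 0 < R := lt_trans (by exact_mod_cast ha) haR
  obtain ⟨b, hab, hbR⟩ := EReal.lt_iff_exists_real_btwn.1 haR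
  rw [EReal.coe_lt_coe_iff] at hab
  have h0 : ξ 0 = 0 := by simpa using hξ.even_deriv 0
  have hsm : ContDiffOn ℝ ∞ (reflect (-1) ξ) {r : ℝ | ((|r| : ℝ) : EReal) < R} := by
    refine contDiffOn_reflect hR hξ.smooth fun j => ?_
    -- With `ε = -1` the matching condition is automatic in odd order and says that the derivative
    -- vanishes in even order.
    rcases Nat.even_or_odd' j with ⟨k, rfl | rfl⟩
    · rw [hξ.even_deriv]; simp
    · rw [pow_succ, pow_mul]; simp
  -- The cutoff is even, equals `1` for `|r| ≤ a` and is supported in `|r| ≤ b < R`, where the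
  -- reflection is smooth; the product is thus smooth and odd on the whole line.
  let φ : ContDiffBump (0 : ℝ) := ⟨a, b, ha, hab⟩
  refine ⟨fun r => φ r * reflect (-1) ξ r, ?_, fun r => ?_, fun r hr => ?_⟩
  · refine contDiff_iff_contDiffAt.2 fun r => ?_
    by_cases hr : r ∈ tsupport φ
    · rw [φ.tsupport_eq, Metric.mem_closedBall, Real.dist_eq, sub_zero] at hr
      have hrR : ((|r| : ℝ) : EReal) < R := lt_of_le_of_lt (EReal.coe_le_coe_iff.2 hr) hbR
      exact φ.contDiff.contDiffAt.mul
        ((hsm r hrR).contDiffAt ((isOpen_setOf_abs_lt R).mem_nhds hrR))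
    · refine (contDiffAt_const (c := (0 : ℝ))).congr_of_eventuallyEq ?_
      filter_upwards [notMem_tsupport_iff_eventuallyEq.1 hr] with s hs
      simp [hs]
  · simp only [reflect_neg_one_neg h0, φ.neg]
    ring
  · have : φ r = 1 := φ.one_of_mem_closedBall (by simpa [abs_of_nonneg hr.1] using hr.2)
    simp [this, reflect, hr.1]

/-! ### Even data of a model warping. -/

/-- An even smooth function vanishing at the origin is `r²` times a smooth even function. -/
theorem exists_even_contDiff_eq_sq_mul {h : ℝ → ℝ} (hh : ContDiff ℝ ∞ h)
    (heven : ∀ r, h (-r) = h r) (h0 : h 0 = 0) :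
    ∃ p : ℝ → ℝ, ContDiff ℝ ∞ p ∧ (∀ r, p (-r) = p r) ∧ ∀ r, h r = r ^ 2 * p r := by
  obtain ⟨g, hg, hge, hd⟩ := exists_deriv_eq_mul_of_even hh heven
  refine ⟨_, contDiff_integral_pow_mul_comp_mul hg 1, fun r => ?_, fun r => ?_⟩
  · simp only [mul_neg, hge]
  -- Integrating `d/dt h(t r) = r² t g(t r)` over `[0,1]` gives the quotient as `∫ t g(t r) dt`.
  · have hd' : ∀ t ∈ uIcc (0 : ℝ) 1,
        HasDerivAt (fun t => h (t * r)) (r ^ 2 * (t ^ 1 * g (t * r))) t := by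
      intro t _
      have h1 : HasDerivAt (fun t => t * r) r t := by
        simpa using (hasDerivAt_id t).mul_const r
      refine ((hd (t * r)).comp t h1).congr_deriv ?_
      ring
    have hc : Continuous fun t => r ^ 2 * (t ^ 1 * g (t * r)) := by
      have := hg.continuous
      fun_prop
    have := intervalIntegral.integral_eq_sub_of_hasDerivAt hd' (hc.intervalIntegrable _ _)
    rw [intervalIntegral.integral_const_mul] at this
    rw [this]
    simp [h0]

/-- Smooth even data on the whole line describing a model warping on `[0, a]`: `ξ(r) = r q(r)` and
`q(r)² + r² p(r) = 1`, while `r q₁(r)` and `r p₁(r)` are the derivatives of `q` and `p`. -/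
structure EvenData (ξ : ℝ → ℝ) (a : ℝ) (q q₁ p p₁ : ℝ → ℝ) : Prop where
  smooth_q : ContDiff ℝ ∞ q
  smooth_p : ContDiff ℝ ∞ p
  even_q : ∀ r, q (-r) = q r
  even_p : ∀ r, p (-r) = p r
  deriv_q : ∀ r, HasDerivAt q (r * q₁ r) r
  deriv_p : ∀ r, HasDerivAt p (r * p₁ r) r
  sq_add : ∀ r, q r ^ 2 + r ^ 2 * p r = 1
  q_pos : ∀ r, |r| ≤ a → 0 < q r
  eq_mul : ∀ r ∈ Icc 0 a, ξ r = r * q r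
  q_zero : q 0 = 1

/-- Oddness of the extension gives `ξ = r q`, and `ξ'(0) = 1` gives `q(0) = 1`. Hence `1 - q²` is
even and vanishes at `0`, so it is divisible by `r²`; this is what makes the metric smooth at the
pole. -/
theorem IsModelWarping.exists_evenData {R : EReal} {ξ : ℝ → ℝ} (hξ : IsModelWarping R ξ)
    {a : ℝ} (ha : 0 < a) (haR : (a : EReal) < R) : ∃ q q₁ p p₁, EvenData ξ a q q₁ p p₁ := by
  have hR : 0 < R := lt_trans (by exact_mod_cast ha) haR
  obtain ⟨f, hf, hodd, hfξ⟩ := hξ.exists_odd_extension ha haR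
  obtain ⟨q, hq, hqe, hfq⟩ := exists_even_contDiff_eq_mul hf hodd
  have hq0 : q 0 = 1 := by
    have hm : (0 : ℝ) ∈ radii R := ⟨le_rfl, by simpa using hR⟩
    have h1 : HasDerivAt f (q 0) 0 := by
      have := (hasDerivAt_id (0 : ℝ)).mul (hq.differentiable (by simp) 0).hasDerivAt
      simp only [id, one_mul, zero_mul, add_zero] at this
      rwa [show id * q = f from funext fun r => (hfq r).symm] at this
    have h2 : HasDerivWithinAt ξ (q 0) (radii R) 0 := by
      refine (h1.hasDerivWithinAt (s := radii R)).congr_of_eventuallyEq ?_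
        (hfξ 0 ⟨le_rfl, ha.le⟩).symm
      filter_upwards [self_mem_nhdsWithin, mem_nhdsWithin_of_mem_nhds (Iio_mem_nhds ha)]
        with r hr hra
      exact (hfξ r ⟨hr.1, le_of_lt hra⟩).symm
    rw [← hξ.deriv_one, h2.derivWithin (uniqueDiffOn_radii R 0 hm)]
  have hpos : ∀ r ∈ Icc 0 a, 0 < q r := by
    intro r hr
    rcases hr.1.eq_or_lt with rfl | h
    · rw [hq0]; exact one_pos
    · have := hξ.pos r h ((EReal.coe_le_coe_iff.2 hr.2).trans_lt haR)
      rw [← hfξ r hr, hfq] at this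
      exact pos_of_mul_pos_right this h.le
  obtain ⟨p, hp, hpe, hpq⟩ := exists_even_contDiff_eq_sq_mul (h := fun r => 1 - q r ^ 2)
    (contDiff_const.sub (hq.pow 2)) (fun r => by simp only [hqe]) (by simp [hq0])
  obtain ⟨q₁, -, -, hq₁⟩ := exists_deriv_eq_mul_of_even hq hqe
  obtain ⟨p₁, -, -, hp₁⟩ := exists_deriv_eq_mul_of_even hp hpe
  refine ⟨q, q₁, p, p₁, hq, hp, hqe, hpe, hq₁, hp₁, fun r => ?_, fun r hr => ?_, fun r hr => ?_,
    hq0⟩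
  · linarith [hpq r]
  · rcases abs_choice r with h | h
    · exact hpos r ⟨h ▸ abs_nonneg r, h ▸ hr⟩
    · rw [← hqe r]
      exact hpos (-r) ⟨h ▸ abs_nonneg r, h ▸ hr⟩
  · rw [← hfξ r hr, hfq]

/-- The smooth even extension `log c + (n - 1) log q` of `ψ`. -/
noncomputable def evenPsi (n : ℕ) (c : ℝ) (q : ℝ → ℝ) (r : ℝ) : ℝ :=
  Real.log c + ((n : ℝ) - 1) * Real.log (q r)

namespace EvenData

variable {ξ : ℝ → ℝ} {a : ℝ} {q q₁ p p₁ : ℝ → ℝ}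

theorem psi_eq (h : EvenData ξ a q q₁ p p₁) (n : ℕ) (c : ℝ) {r : ℝ} (hr : r ∈ Icc 0 a) :
    psi n c ξ r = evenPsi n c q r := by
  unfold psi evenPsi
  split_ifs with h0
  · rw [h0, h.q_zero]; simp
  · rw [h.eq_mul r hr, mul_div_cancel_left₀ _ h0]

theorem hasDerivAt_evenPsi (h : EvenData ξ a q q₁ p p₁) (n : ℕ) (c : ℝ) {r : ℝ} (hr : |r| ≤ a) :
    HasDerivAt (evenPsi n c q) (r * (((n : ℝ) - 1) * q₁ r / q r)) r := by
  refine ((((h.deriv_q r).log (h.q_pos r hr).ne').const_mul ((n : ℝ) - 1)).const_add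
    (Real.log c)).congr_deriv ?_
  ring

/-- The derivative of the relation `q² + r² p = 1`. -/
theorem deriv_sq_add (h : EvenData ξ a q q₁ p p₁) (r : ℝ) :
    r ^ 2 * (2 * q r * q₁ r + r ^ 2 * p₁ r + 2 * p r) = 0 := by
  have h1 := ((h.deriv_q r).pow 2).add (((hasDerivAt_id r).pow 2).mul (h.deriv_p r))
  have h2 : HasDerivAt (fun r => q r ^ 2 + r ^ 2 * p r) 0 r := by
    rw [funext h.sq_add]; exact hasDerivAt_const r 1
  have h3 := h1.unique h2
  simp only [Pi.pow_apply, id] at h3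
  push_cast at h3
  linear_combination r * h3

variable {n : ℕ}

theorem modelMetric_eq (h : EvenData ξ a q q₁ p p₁) {x : EuclideanSpace ℝ (Fin n)}
    (hx : ‖x‖ ≤ a) :
    modelMetric ξ x = (q ‖x‖ ^ 2) • euclid n + p ‖x‖ • tensorSq (innerSL ℝ x) := by
  unfold modelMetric
  split_ifs with h0
  · subst h0
    ext v w
    simp [h.q_zero, tensorSq]
  · have hn : ‖x‖ ≠ 0 := norm_ne_zero_iff.2 h0
    have hp : p ‖x‖ = (1 - q ‖x‖ ^ 2) / ‖x‖ ^ 2 := by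
      rw [eq_div_iff (by positivity)]
      linarith [h.sq_add ‖x‖]
    rw [h.eq_mul _ ⟨norm_nonneg x, hx⟩, hp]
    ext v w
    simp only [tensorSq, dthetaSq, dr, euclid, add_apply,
      smul_apply, sub_apply, innerSL_apply_apply,
      ContinuousLinearMap.smulRight_apply, smul_eq_mul]
    field_simp
    ring

theorem contDiffOn_evenPsi_norm (h : EvenData ξ a q q₁ p p₁) (n : ℕ) (c : ℝ) (m : ℕ) :
    ContDiffOn ℝ ∞ (fun x : EuclideanSpace ℝ (Fin m) => evenPsi n c q ‖x‖)
      (Metric.closedBall 0 a) := by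
  unfold evenPsi
  refine contDiffOn_const.add (contDiffOn_const.mul (ContDiffOn.log ?_ fun x hx => ?_))
  · exact (contDiff_comp_norm_of_even h.smooth_q h.even_q).contDiffOn
  · refine (h.q_pos _ ?_).ne'
    simpa using hx

end EvenData

/-! ### Rotationally symmetric metrics on `ℝⁿ × ℝ`. -/

section RadialMetric

variable {n : ℕ}

/-- The rotationally symmetric form `E ds² + Q ⟨·,·⟩ + P ⟨x,·⟩²` on `ℝⁿ × ℝ`, with coefficients
depending on `x`. -/
noncomputable def radialForm (e Q P : EuclideanSpace ℝ (Fin n) → ℝ)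
    (y : EuclideanSpace ℝ (Fin n) × ℝ) :
    (EuclideanSpace ℝ (Fin n) × ℝ) →L[ℝ] (EuclideanSpace ℝ (Fin n) × ℝ) →L[ℝ] ℝ :=
  e y.1 • tensorSq (ContinuousLinearMap.snd ℝ (EuclideanSpace ℝ (Fin n)) ℝ) +
    (Q y.1 • (euclid n).bilinearComp (ContinuousLinearMap.fst ℝ (EuclideanSpace ℝ (Fin n)) ℝ)
      (ContinuousLinearMap.fst ℝ (EuclideanSpace ℝ (Fin n)) ℝ) +
    P y.1 • tensorSq ((innerSL ℝ y.1).comp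
      (ContinuousLinearMap.fst ℝ (EuclideanSpace ℝ (Fin n)) ℝ)))

variable {e Q P : EuclideanSpace ℝ (Fin n) → ℝ}

theorem radialForm_apply (y V W : EuclideanSpace ℝ (Fin n) × ℝ) :
    radialForm e Q P y V W = e y.1 * (V.2 * W.2) + (Q y.1 * inner ℝ V.1 W.1 +
      P y.1 * (inner ℝ y.1 V.1 * inner ℝ y.1 W.1)) := by
  simp only [radialForm, tensorSq, euclid, add_apply, smul_apply,
    ContinuousLinearMap.smulRight_apply, ContinuousLinearMap.coe_snd',
    ContinuousLinearMap.bilinearComp_apply, ContinuousLinearMap.coe_fst',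
    ContinuousLinearMap.comp_apply, innerSL_apply_apply, smul_eq_mul]
  rfl

theorem contDiffOn_smul_clm {F G : Type*} [NormedAddCommGroup F] [NormedSpace ℝ F]
    [NormedAddCommGroup G] [NormedSpace ℝ G] {s : Set F} {f : F → ℝ} {B : F → F →L[ℝ] G}
    (hf : ContDiffOn ℝ ∞ f s) (hB : ContDiffOn ℝ ∞ B s) : ContDiffOn ℝ ∞ (fun y => f y • B y) s :=
  hf.smul hB

theorem contDiffOn_radialForm {s : Set (EuclideanSpace ℝ (Fin n))} (he : ContDiffOn ℝ ∞ e s)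
    (hQ : ContDiffOn ℝ ∞ Q s) (hP : ContDiffOn ℝ ∞ P s) :
    ContDiffOn ℝ ∞ (radialForm e Q P) (s ×ˢ univ) := by
  have hm : MapsTo (Prod.fst : EuclideanSpace ℝ (Fin n) × ℝ → _) (s ×ˢ univ) s := fun y hy => hy.1
  have hfst := (contDiff_fst (𝕜 := ℝ) (n := ∞) (E := EuclideanSpace ℝ (Fin n))
    (F := ℝ)).contDiffOn (s := s ×ˢ univ)
  have hα : ContDiff ℝ ∞ fun y : EuclideanSpace ℝ (Fin n) × ℝ => (innerSL ℝ y.1).comp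
      (ContinuousLinearMap.fst ℝ (EuclideanSpace ℝ (Fin n)) ℝ) :=
    ((innerSL ℝ).contDiff.comp contDiff_fst).clm_comp contDiff_const
  exact (contDiffOn_smul_clm (he.comp hfst hm) contDiffOn_const).add
    ((contDiffOn_smul_clm (hQ.comp hfst hm) contDiffOn_const).add
      (contDiffOn_smul_clm (hP.comp hfst hm) (hα.smulRight hα).contDiffOn))

theorem fderiv_radialForm_apply {x : EuclideanSpace ℝ (Fin n)} {s β σ π : ℝ}
    (hd : DifferentiableAt ℝ (radialForm e Q P) (x, s))
    (he : HasFDerivAt e (β • innerSL ℝ x) x) (hQ : HasFDerivAt Q (σ • innerSL ℝ x) x)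
    (hP : HasFDerivAt P (π • innerSL ℝ x) x) (V W Z : EuclideanSpace ℝ (Fin n) × ℝ) :
    fderiv ℝ (radialForm e Q P) (x, s) V W Z =
      β * inner ℝ x V.1 * (W.2 * Z.2) + (σ * inner ℝ x V.1 * inner ℝ W.1 Z.1 +
        (π * inner ℝ x V.1 * (inner ℝ x W.1 * inner ℝ x Z.1) +
          P x * (inner ℝ V.1 W.1 * inner ℝ x Z.1 + inner ℝ x W.1 * inner ℝ V.1 Z.1))) := by
  have h1 : HasFDerivAt (fun y => radialForm e Q P y W Z)
      (((fderiv ℝ (radialForm e Q P) (x, s)).flip W).flip Z) (x, s) :=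
    ((hd.hasFDerivAt.clm_apply (hasFDerivAt_const W _)).clm_apply
      (hasFDerivAt_const Z _)).congr_fderiv (by ext <;> simp)
  have hfst := hasFDerivAt_fst (𝕜 := ℝ) (p := (x, s))
  have hin : ∀ w : EuclideanSpace ℝ (Fin n),
      HasFDerivAt (fun y : EuclideanSpace ℝ (Fin n) × ℝ => inner ℝ y.1 w)
        ((innerSL ℝ w).comp (ContinuousLinearMap.fst ℝ _ _)) (x, s) := fun w => by
    refine ((innerSL ℝ w).hasFDerivAt.comp _ hfst).congr_of_eventuallyEq
      (Eventually.of_forall fun y => ?_)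
    simp [real_inner_comm]
  have h2 := ((he.comp (x, s) hfst).mul_const (W.2 * Z.2)).add
    (((hQ.comp (x, s) hfst).mul_const (inner ℝ W.1 Z.1)).add
      ((hP.comp (x, s) hfst).mul ((hin W.1).mul (hin Z.1))))
  have h3 := h1.unique (h2.congr_of_eventuallyEq
    (Eventually.of_forall fun y => radialForm_apply y W Z))
  have h4 := DFunLike.congr_fun h3 V
  simp only [ContinuousLinearMap.flip_apply] at h4
  rw [h4]
  simp [real_inner_comm]
  ring

theorem EvenData.warpedMetric_eq {ξ ψ : ℝ → ℝ} {a : ℝ} {q q₁ p p₁ : ℝ → ℝ}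
    (h : EvenData ξ a q q₁ p p₁) {φ : ℝ → ℝ} (hψ : ∀ r ∈ Icc 0 a, ψ r = φ r)
    {y : EuclideanSpace ℝ (Fin n) × ℝ} (hy : ‖y.1‖ ≤ a) :
    warpedMetric ξ ψ y = radialForm (fun x => Real.exp (-2 * φ ‖x‖)) (fun x => q ‖x‖ ^ 2)
      (fun x => p ‖x‖) y := by
  unfold warpedMetric radialForm
  rw [h.modelMetric_eq hy, hψ _ ⟨norm_nonneg _, hy⟩]
  rfl

theorem radialForm_symm (y V W : EuclideanSpace ℝ (Fin n) × ℝ) :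
    radialForm e Q P y V W = radialForm e Q P y W V := by
  rw [radialForm_apply, radialForm_apply, real_inner_comm]
  ring

/-- The spatial part has eigenvalue `Q` on the complement of `x` and `Q + ‖x‖² P` along `x`;
Cauchy–Schwarz covers the case `P < 0`. -/
theorem radialForm_pos {y : EuclideanSpace ℝ (Fin n) × ℝ} (he : 0 < e y.1) (hQ : 0 < Q y.1)
    (hQP : 0 < Q y.1 + ‖y.1‖ ^ 2 * P y.1) {V : EuclideanSpace ℝ (Fin n) × ℝ} (hV : V ≠ 0) :
    0 < radialForm e Q P y V V := by
  rw [radialForm_apply, real_inner_self_eq_norm_sq]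
  have hcs := abs_real_inner_le_norm y.1 V.1
  have hcs2 : inner ℝ y.1 V.1 * inner ℝ y.1 V.1 ≤ ‖y.1‖ ^ 2 * ‖V.1‖ ^ 2 := by
    have := mul_self_le_mul_self (abs_nonneg _) hcs
    rw [abs_mul_abs_self] at this
    linarith
  have hin : 0 ≤ inner ℝ y.1 V.1 * inner ℝ y.1 V.1 := mul_self_nonneg _
  have hspace : V.1 ≠ 0 → 0 < Q y.1 * ‖V.1‖ ^ 2 +
      P y.1 * (inner ℝ y.1 V.1 * inner ℝ y.1 V.1) := by
    intro h
    have hp : 0 < ‖V.1‖ ^ 2 := by positivity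
    rcases le_total 0 (P y.1) with hP | hP
    · positivity
    · have := mul_le_mul_of_nonpos_left hcs2 hP
      have := mul_pos hQP hp
      linarith
  by_cases h1 : V.1 = 0
  · have h2 : V.2 ≠ 0 := fun h2 => hV (Prod.ext h1 h2)
    have : 0 < V.2 * V.2 := mul_self_pos.2 h2
    simp only [h1, norm_zero, inner_zero_right]
    have := mul_pos he this
    simpa using this
  · have := hspace h1
    have := mul_nonneg he.le (mul_self_nonneg V.2)
    linarith

end RadialMetric

/-! ### The profile integral and its height bound. -/

section Profile

theorem one_sub_sq_pos {r₀ H₀ r : ℝ} (hr₀ : 0 < r₀) (hH₀ : H₀ = -1 / r₀) (hr : |r| < r₀) :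
    0 < 1 - H₀ ^ 2 * r ^ 2 := by
  have h : r ^ 2 < r₀ ^ 2 := sq_lt_sq' (by linarith [neg_abs_le r]) (by linarith [le_abs_self r])
  have : H₀ ^ 2 * r ^ 2 = r ^ 2 / r₀ ^ 2 := by
    rw [hH₀]; field_simp
  rw [this, sub_pos, div_lt_one (by positivity)]
  exact h

theorem hasDerivAt_sqrt_one_sub {H₀ r : ℝ} (hr : 0 < 1 - H₀ ^ 2 * r ^ 2) :
    HasDerivAt (fun τ => Real.sqrt (1 - H₀ ^ 2 * τ ^ 2))
      (-(H₀ ^ 2 * r) / Real.sqrt (1 - H₀ ^ 2 * r ^ 2)) r := by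
  have h1 : HasDerivAt (fun τ : ℝ => 1 - H₀ ^ 2 * τ ^ 2) (-(H₀ ^ 2 * (2 * r))) r := by
    have := (((hasDerivAt_id r).pow 2).const_mul (H₀ ^ 2)).const_sub 1
    simpa using this
  refine (h1.sqrt hr.ne').congr_deriv ?_
  have := (Real.sqrt_pos.2 hr).ne'
  field_simp

variable {r₀ H₀ : ℝ}

/-- The profile of the lower hemisphere, whose derivative is `-H₀ τ / √(1 - H₀² τ²)`. -/
theorem hasDerivAt_hemisphere (hr₀ : 0 < r₀) (hH₀ : H₀ = -1 / r₀) {r : ℝ} (hr : |r| < r₀) :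
    HasDerivAt (fun τ => -r₀ * Real.sqrt (1 - H₀ ^ 2 * τ ^ 2))
      (-(H₀ * r / Real.sqrt (1 - H₀ ^ 2 * r ^ 2))) r := by
  refine ((hasDerivAt_sqrt_one_sub (one_sub_sq_pos hr₀ hH₀ hr)).const_mul (-r₀)).congr_deriv ?_
  rw [hH₀]
  field_simp

/-- The integrand blows up at `r₀`, but it is nonnegative and has a primitive continuous up to `r₀`,
which forces integrability. -/
theorem intervalIntegrable_hemisphere (hr₀ : 0 < r₀) (hH₀ : H₀ = -1 / r₀) :
    IntervalIntegrable (fun τ => -(H₀ * τ / Real.sqrt (1 - H₀ ^ 2 * τ ^ 2))) volume 0 r₀ := by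
  refine intervalIntegral.intervalIntegrable_deriv_of_nonneg
    (g := fun τ => -r₀ * Real.sqrt (1 - H₀ ^ 2 * τ ^ 2)) (by fun_prop) (fun τ hτ => ?_)
    (fun τ hτ => ?_)
  all_goals rw [min_eq_left hr₀.le, max_eq_right hr₀.le] at hτ
  · exact hasDerivAt_hemisphere hr₀ hH₀ (by rw [abs_of_pos hτ.1]; exact hτ.2)
  · have hH : H₀ < 0 := by rw [hH₀]; exact div_neg_of_neg_of_pos (by norm_num) hr₀
    rw [← neg_div, ← neg_mul]
    exact div_nonneg (mul_nonneg (by linarith) hτ.1.le) (Real.sqrt_nonneg _)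

theorem integral_hemisphere (hr₀ : 0 < r₀) (hH₀ : H₀ = -1 / r₀) {r : ℝ} (hr : r ∈ Icc 0 r₀) :
    ∫ τ in r..r₀, -(H₀ * τ / Real.sqrt (1 - H₀ ^ 2 * τ ^ 2)) =
      r₀ * Real.sqrt (1 - H₀ ^ 2 * r ^ 2) := by
  have hint : IntervalIntegrable (fun τ => -(H₀ * τ / Real.sqrt (1 - H₀ ^ 2 * τ ^ 2)))
      volume r r₀ := by
    refine (intervalIntegrable_hemisphere hr₀ hH₀).mono_set ?_
    rw [uIcc_of_le hr.2, uIcc_of_le hr₀.le]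
    exact Icc_subset_Icc_left hr.1
  rw [intervalIntegral.integral_eq_sub_of_hasDerivAt_of_le hr.2
    (f := fun τ => -r₀ * Real.sqrt (1 - H₀ ^ 2 * τ ^ 2)) (by fun_prop) (fun τ hτ => ?_) hint]
  · have : 1 - H₀ ^ 2 * r₀ ^ 2 = 0 := by rw [hH₀]; field_simp; ring
    simp [this]
  · exact hasDerivAt_hemisphere hr₀ hH₀ (by rw [abs_of_pos (hr.1.trans_lt hτ.1)]; exact hτ.2)

theorem intervalIntegrable_profileDensity (hr₀ : 0 < r₀) (hH₀ : H₀ = -1 / r₀) {ψ : ℝ → ℝ}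
    (hψ : ContinuousOn ψ (Icc 0 r₀)) :
    IntervalIntegrable (profileDensity ψ H₀) volume 0 r₀ := by
  have h1 := (intervalIntegrable_hemisphere hr₀ hH₀).neg
  simp only [Pi.neg_def, neg_neg] at h1
  refine h1.mul_continuousOn ?_
  rw [uIcc_of_le hr₀.le]
  exact hψ.rexp

theorem profile_congr {φ ψ : ℝ → ℝ} (h : ∀ r ∈ Icc 0 r₀, ψ r = φ r) {r : ℝ} (hr : r ∈ Icc 0 r₀) :
    profile ψ H₀ r₀ r = profile φ H₀ r₀ r := by
  refine intervalIntegral.integral_congr fun τ hτ => ?_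
  rw [uIcc_of_ge hr.2] at hτ
  simp only [profileDensity, h τ ⟨hr.1.trans hτ.1, hτ.2⟩]

/-- Continuity of `φ` to the left of `0` is what yields a two-sided derivative at `r = 0`. It is
later applied to `evenPsi`, since `psi` is uncontrolled at negative radii. -/
theorem hasDerivAt_profile (hr₀ : 0 < r₀) (hH₀ : H₀ = -1 / r₀) {φ : ℝ → ℝ}
    (hφ : ContinuousOn φ (Icc (-r₀) r₀)) {r : ℝ} (hr0 : 0 ≤ r) (hr : r < r₀) :
    HasDerivAt (profile φ H₀ r₀) (profileDensity φ H₀ r) r := by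
  have hc : ContinuousOn (profileDensity φ H₀) (Ioo (-r₀) r₀) := by
    refine ContinuousOn.mul (ContinuousOn.div (by fun_prop) (by fun_prop) fun τ hτ => ?_)
      (hφ.mono Ioo_subset_Icc_self).rexp
    exact (Real.sqrt_pos.2 (one_sub_sq_pos hr₀ hH₀ (abs_lt.2 hτ))).ne'
  have hm : r ∈ Ioo (-r₀) r₀ := ⟨by linarith, hr⟩
  refine intervalIntegral.integral_hasDerivAt_right ?_
    (hc.stronglyMeasurableAtFilter isOpen_Ioo r hm) (hc.continuousAt (isOpen_Ioo.mem_nhds hm))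
  refine (intervalIntegrable_profileDensity hr₀ hH₀
    (hφ.mono (Icc_subset_Icc_left (by linarith)))).symm.mono_set ?_
  rw [uIcc_of_ge hr.le, uIcc_of_ge hr₀.le]
  exact Icc_subset_Icc_left hr0

theorem profile_nonneg_and_le (hr₀ : 0 < r₀) (hH₀ : H₀ = -1 / r₀) {ψ : ℝ → ℝ}
    (hψ : ContinuousOn ψ (Icc 0 r₀)) {S : ℝ} (hS : ∀ r ∈ Icc 0 r₀, ψ r ≤ S) {r : ℝ}
    (hr : r ∈ Icc 0 r₀) :
    0 ≤ profile ψ H₀ r₀ r ∧ profile ψ H₀ r₀ r ≤ Real.exp S * r₀ := by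
  have hH : H₀ < 0 := by rw [hH₀]; exact div_neg_of_neg_of_pos (by norm_num) hr₀
  have hsub : uIcc r r₀ ⊆ uIcc 0 r₀ := by
    rw [uIcc_of_le hr.2, uIcc_of_le hr₀.le]
    exact Icc_subset_Icc_left hr.1
  have hint1 := ((intervalIntegrable_profileDensity hr₀ hH₀ hψ).mono_set hsub).neg
  have hint2 := ((intervalIntegrable_hemisphere hr₀ hH₀).mono_set hsub).const_mul (Real.exp S)
  have heq : profile ψ H₀ r₀ r = ∫ τ in r..r₀, -profileDensity ψ H₀ τ := by
    rw [intervalIntegral.integral_neg, profile, intervalIntegral.integral_symm]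
  have hden : ∀ τ ∈ Icc r r₀, 0 ≤ -(H₀ * τ / Real.sqrt (1 - H₀ ^ 2 * τ ^ 2)) := by
    intro τ hτ
    rw [← neg_div, ← neg_mul]
    -- The endpoint `τ = r₀` is included: the quotient by `0` has the value `0` there.
    exact div_nonneg (mul_nonneg (by linarith) (hr.1.trans hτ.1)) (Real.sqrt_nonneg _)
  have hpd : ∀ τ, -profileDensity ψ H₀ τ =
      Real.exp (ψ τ) * -(H₀ * τ / Real.sqrt (1 - H₀ ^ 2 * τ ^ 2)) := by
    intro τ
    unfold profileDensity
    ring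
  rw [heq]
  constructor
  · refine intervalIntegral.integral_nonneg hr.2 fun τ hτ => ?_
    rw [hpd]
    exact mul_nonneg (Real.exp_pos _).le (hden τ hτ)
  · calc _ ≤ ∫ τ in r..r₀, Real.exp S * -(H₀ * τ / Real.sqrt (1 - H₀ ^ 2 * τ ^ 2)) := by
          refine intervalIntegral.integral_mono_on hr.2 hint1 hint2 fun τ hτ => ?_
          rw [hpd]
          exact mul_le_mul_of_nonneg_right
            (Real.exp_le_exp.2 (hS τ ⟨hr.1.trans hτ.1, hτ.2⟩)) (hden τ hτ)
      _ ≤ _ := by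
          rw [intervalIntegral.integral_const_mul, integral_hemisphere hr₀ hH₀ hr]
          refine mul_le_mul_of_nonneg_left ?_ (Real.exp_pos S).le
          refine mul_le_of_le_one_right hr₀.le (Real.sqrt_le_one.2 ?_)
          nlinarith [mul_nonneg (sq_nonneg H₀) (sq_nonneg r)]

end Profile

/-! ### Traces of rank-one perturbations of the identity. -/

variable {n : ℕ}

theorem gram_eq_smul_one_add_vecMulVec {b : EuclideanSpace ℝ (Fin n) → EuclideanSpace ℝ (Fin n) → ℝ}
    {x : EuclideanSpace ℝ (Fin n)} {A B : ℝ}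
    (h : ∀ v w, b v w = A * inner ℝ v w + B * (inner ℝ x v * inner ℝ x w)) :
    gram b = A • (1 : Matrix (Fin n) (Fin n) ℝ) + B • Matrix.vecMulVec x x := by
  ext i j
  simp [gram, h, Matrix.one_apply, Matrix.vecMulVec_apply, EuclideanSpace.inner_single_right]
  grind

theorem trace_inv_mul_rankOne (x : EuclideanSpace ℝ (Fin n)) {A₁ B₁ A₂ B₂ : ℝ}
    (hA : A₁ ≠ 0) (hB : A₁ + B₁ * ‖x‖ ^ 2 ≠ 0) :
    ((A₁ • (1 : Matrix (Fin n) (Fin n) ℝ) + B₁ • Matrix.vecMulVec x x)⁻¹ *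
      (A₂ • (1 : Matrix (Fin n) (Fin n) ℝ) + B₂ • Matrix.vecMulVec x x)).trace =
    ((n : ℝ) - 1) * (A₂ / A₁) + (A₂ + B₂ * ‖x‖ ^ 2) / (A₁ + B₁ * ‖x‖ ^ 2) := by
  set X : Matrix (Fin n) (Fin n) ℝ := Matrix.vecMulVec x x with hX
  have hxx : (x : Fin n → ℝ) ⬝ᵥ x = ‖x‖ ^ 2 := by
    rw [EuclideanSpace.real_norm_sq_eq]
    exact Finset.sum_congr rfl fun i _ => (sq _).symm
  have hXX : X * X = ‖x‖ ^ 2 • X := by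
    rw [hX, Matrix.vecMulVec_mul_vecMulVec, hxx]
    ext i j
    simp [Matrix.vecMulVec_apply]
    ring
  have htr : X.trace = ‖x‖ ^ 2 := by rw [hX, Matrix.trace_vecMulVec, hxx]
  set ρ := ‖x‖ ^ 2
  -- The Sherman–Morrison formula, from `X * X = ‖x‖² • X`.
  have hinv : (A₁ • (1 : Matrix (Fin n) (Fin n) ℝ) + B₁ • X)⁻¹ =
      A₁⁻¹ • (1 : Matrix (Fin n) (Fin n) ℝ) - (A₁⁻¹ * B₁ / (A₁ + B₁ * ρ)) • X := by
    refine Matrix.inv_eq_right_inv ?_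
    simp only [add_mul, mul_sub, Matrix.smul_mul, Matrix.mul_smul, one_mul, mul_one, hXX, smul_smul]
    rw [inv_mul_cancel₀ hA, one_smul]
    have : A₁⁻¹ * B₁ - (A₁⁻¹ * B₁ / (A₁ + B₁ * ρ) * A₁ +
        A₁⁻¹ * B₁ / (A₁ + B₁ * ρ) * (B₁ * ρ)) = 0 := by
      field_simp
      ring
    have h2 := congrArg (fun t : ℝ => t • X) this
    simp only [sub_smul, add_smul, zero_smul] at h2
    rw [add_sub_assoc, h2, add_zero]
  rw [hinv]
  simp only [mul_add, sub_mul, Matrix.smul_mul, Matrix.mul_smul, one_mul, mul_one, hXX, smul_smul,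
    Matrix.trace_add, Matrix.trace_sub, Matrix.trace_smul, htr, Matrix.trace_one, Fintype.card_fin,
    smul_eq_mul]
  field_simp
  ring

theorem meanCurvature_eq_of_rankOne
    {g : EuclideanSpace ℝ (Fin n) × ℝ →
      (EuclideanSpace ℝ (Fin n) × ℝ) →L[ℝ] (EuclideanSpace ℝ (Fin n) × ℝ) →L[ℝ] ℝ}
    {u : EuclideanSpace ℝ (Fin n) → ℝ} {N : EuclideanSpace ℝ (Fin n) × ℝ}
    {x : EuclideanSpace ℝ (Fin n)} {A₁ B₁ A₂ B₂ : ℝ}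
    (h₁ : ∀ v w, firstFundamentalForm g u x v w =
      A₁ * inner ℝ v w + B₁ * (inner ℝ x v * inner ℝ x w))
    (h₂ : ∀ v w, secondFundamentalForm g u N x v w =
      A₂ * inner ℝ v w + B₂ * (inner ℝ x v * inner ℝ x w))
    (hA : A₁ ≠ 0) (hB : A₁ + B₁ * ‖x‖ ^ 2 ≠ 0) :
    meanCurvature g u N x = 1 / (n : ℝ) *
      (((n : ℝ) - 1) * (A₂ / A₁) + (A₂ + B₂ * ‖x‖ ^ 2) / (A₁ + B₁ * ‖x‖ ^ 2)) := by
  unfold meanCurvature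
  rw [gram_eq_smul_one_add_vecMulVec h₁, gram_eq_smul_one_add_vecMulVec h₂,
    trace_inv_mul_rankOne x hA hB]

/-! ### Normal and mean curvature of a radial graph. -/

section Graph

variable {U κ : EuclideanSpace ℝ (Fin n) → ℝ} {Ω : Set (EuclideanSpace ℝ (Fin n))}

theorem fderiv_graphMap_apply {x : EuclideanSpace ℝ (Fin n)} {k : ℝ}
    (h : HasFDerivAt U (k • innerSL ℝ x) x) (v : EuclideanSpace ℝ (Fin n)) :
    fderiv ℝ (graphMap U) x v = (v, k * inner ℝ x v) := by
  have : HasFDerivAt (graphMap U) ((ContinuousLinearMap.id ℝ _).prod (k • innerSL ℝ x)) x :=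
    (hasFDerivAt_id x).prodMk h
  rw [this.fderiv]
  simp

theorem fderiv_fderiv_graphMap_apply (hΩ : IsOpen Ω) (hU : ContDiffOn ℝ ∞ U Ω)
    (h : ∀ x ∈ Ω, HasFDerivAt U (κ x • innerSL ℝ x) x) {x : EuclideanSpace ℝ (Fin n)} (hx : x ∈ Ω)
    {k : ℝ} (hκ : HasFDerivAt κ (k • innerSL ℝ x) x) (v w : EuclideanSpace ℝ (Fin n)) :
    fderiv ℝ (fderiv ℝ (graphMap U)) x v w =
      (0, k * (inner ℝ x v * inner ℝ x w) + κ x * inner ℝ v w) := by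
  have hF : ContDiffOn ℝ ∞ (graphMap U) Ω := contDiffOn_id.prodMk hU
  have hd : DifferentiableAt ℝ (fderiv ℝ (graphMap U)) x :=
    ((contDiffOn_infty_iff_fderiv_of_isOpen hΩ).1 hF).2.differentiableOn (by simp) x hx
      |>.differentiableAt (hΩ.mem_nhds hx)
  have h1 : HasFDerivAt (fun y => fderiv ℝ (graphMap U) y w)
      ((fderiv ℝ (fderiv ℝ (graphMap U)) x).flip w) x :=
    (hd.hasFDerivAt.clm_apply (hasFDerivAt_const w _)).congr_fderiv (by ext <;> simp)
  have hin : HasFDerivAt (fun y : EuclideanSpace ℝ (Fin n) => inner ℝ y w) (innerSL ℝ w) x := by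
    refine (innerSL ℝ w).hasFDerivAt.congr_of_eventuallyEq (Eventually.of_forall fun y => ?_)
    simp [real_inner_comm]
  have h2 : HasFDerivAt (fun y => (w, κ y * inner ℝ y w)) _ x :=
    (hasFDerivAt_const w x).prodMk (hκ.mul hin)
  have h3 := h1.unique (h2.congr_of_eventuallyEq (by
    filter_upwards [hΩ.mem_nhds hx] with y hy
    exact fderiv_graphMap_apply (h y hy) w))
  have h4 := DFunLike.congr_fun h3 v
  rw [ContinuousLinearMap.flip_apply] at h4
  rw [h4]
  ext
  · simp
  · simp [real_inner_comm]
    ring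

/-- The upward unit normals of a radial graph in a rotationally symmetric metric, when the slope `k`
satisfies `e k² (1 - H² r²) = H²`, `k` and `H` being of the same sign. -/
theorem isUpwardUnitNormal_radialForm_iff {e Q P : EuclideanSpace ℝ (Fin n) → ℝ}
    {x : EuclideanSpace ℝ (Fin n)} {k H : ℝ} (hU : HasFDerivAt U (k • innerSL ℝ x) x)
    (he : 0 < e x) (hQ : 0 < Q x) (hQP : Q x + ‖x‖ ^ 2 * P x = 1)
    (hk : e x * k ^ 2 * (1 - H ^ 2 * ‖x‖ ^ 2) = H ^ 2)
    (hsign : 0 < k * H) (N : EuclideanSpace ℝ (Fin n) × ℝ) :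
    IsUpwardUnitNormal (radialForm e Q P) U x N ↔ N = (-H • x, H / (e x * k)) := by
  have hxx : inner ℝ x x = ‖x‖ ^ 2 := real_inner_self_eq_norm_sq x
  have hk0 : k ≠ 0 := left_ne_zero_of_mul hsign.ne'
  constructor
  · rintro ⟨h1, h2, h3⟩
    obtain ⟨ν, m⟩ := N
    simp only [graphMap, radialForm_apply, fderiv_graphMap_apply hU] at h1 h2 h3
    simp only [mul_one, inner_zero_right, mul_zero, add_zero] at h3
    have hm : 0 < m := pos_of_mul_pos_right h3 he.le
    -- Orthogonality tested on `v = x` determines the radial component of `ν`; tested on all `v` it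
    -- then makes `ν` a multiple of `x`.
    have hxν : inner ℝ x ν = -(e x * m * k) * ‖x‖ ^ 2 := by
      have := h1 x
      rw [hxx, real_inner_comm] at this
      linear_combination this - inner ℝ x ν * hQP
    have hν : ν = -(e x * m * k) • x := by
      refine ext_inner_right ℝ fun v => mul_left_cancel₀ hQ.ne' ?_
      rw [inner_smul_left]
      simp only [conj_trivial]
      have := h1 v
      rw [hxν] at this
      linear_combination this + e x * m * k * inner ℝ x v * hQP
    have hνν : inner ℝ ν ν = (e x * m * k) ^ 2 * ‖x‖ ^ 2 := by
      conv_lhs => rw [hν]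
      rw [inner_smul_left, inner_smul_right, hxx]
      simp only [conj_trivial]
      ring
    rw [hνν, hxν] at h2
    have h4 : e x * m ^ 2 + (e x * m * k) ^ 2 * ‖x‖ ^ 2 = 1 := by
      linear_combination h2 - (e x * m * k) ^ 2 * ‖x‖ ^ 2 * hQP
    have h5 : e x * m ^ 2 = 1 - H ^ 2 * ‖x‖ ^ 2 := by
      linear_combination (1 - H ^ 2 * ‖x‖ ^ 2) * h4 - e x * m ^ 2 * ‖x‖ ^ 2 * hk
    have h6 : (e x * m * k) ^ 2 = H ^ 2 := by
      linear_combination hk + e x * k ^ 2 * h5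
    -- Unit length leaves `e m k = ±H`; upwardness, `m > 0`, together with `k H > 0` selects the
    -- sign.
    have h7 : e x * m * k = H := by
      rcases sq_eq_sq_iff_eq_or_eq_neg.1 h6 with h | h
      · exact h
      · exfalso
        have : 0 < e x * m * k * H := by
          have := mul_pos (mul_pos he hm) hsign
          linarith
        rw [h] at this
        nlinarith [sq_nonneg H]
    rw [h7] at hν
    rw [hν, ← h7]
    congr 1
    field_simp
  · rintro rfl
    have h6 : e x * (H / (e x * k)) ^ 2 = 1 - H ^ 2 * ‖x‖ ^ 2 := by
      rw [← sub_eq_zero]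
      have : e x * (H / (e x * k)) ^ 2 * (e x * k ^ 2) = H ^ 2 := by field_simp
      have h8 : e x * k ^ 2 ≠ 0 := by positivity
      refine (mul_eq_zero.1 (?_ : (e x * k ^ 2) * _ = 0)).resolve_left h8
      linear_combination this - hk
    refine ⟨fun v => ?_, ?_, ?_⟩
    · simp only [graphMap, radialForm_apply, fderiv_graphMap_apply hU, inner_smul_left,
        inner_smul_right, hxx, conj_trivial]
      have : e x * (H / (e x * k) * (k * inner ℝ x v)) = H * inner ℝ x v := by field_simp
      linear_combination this - H * inner ℝ x v * hQP
    · simp only [graphMap, radialForm_apply, inner_smul_left,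
        inner_smul_right, hxx, conj_trivial]
      linear_combination h6 + H ^ 2 * ‖x‖ ^ 2 * hQP
    · simp only [graphMap, radialForm_apply, mul_one, inner_zero_right, mul_zero, add_zero]
      have : e x * (H / (e x * k)) = k * H / k ^ 2 := by field_simp
      rw [this]
      positivity

/-- The mean curvature of a radial graph in a rotationally symmetric metric. -/
theorem meanCurvature_radialForm (hn : 1 ≤ n) {g : EuclideanSpace ℝ (Fin n) × ℝ →
      (EuclideanSpace ℝ (Fin n) × ℝ) →L[ℝ] (EuclideanSpace ℝ (Fin n) × ℝ) →L[ℝ] ℝ}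
    {e Q P : EuclideanSpace ℝ (Fin n) → ℝ}
    {x : EuclideanSpace ℝ (Fin n)} {k₁ H β σ π ψ₁ : ℝ}
    (hg : g =ᶠ[𝓝 (x, U x)] radialForm e Q P)
    (hd : DifferentiableAt ℝ (radialForm e Q P) (x, U x))
    (hΩ : IsOpen Ω) (hUs : ContDiffOn ℝ ∞ U Ω)
    (hU : ∀ x ∈ Ω, HasFDerivAt U (κ x • innerSL ℝ x) x) (hx : x ∈ Ω)
    (hκ : HasFDerivAt κ (k₁ • innerSL ℝ x) x)
    (hDe : HasFDerivAt e (β • innerSL ℝ x) x) (hDQ : HasFDerivAt Q (σ • innerSL ℝ x) x)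
    (hDP : HasFDerivAt P (π • innerSL ℝ x) x)
    (he : 0 < e x) (hQ : 0 < Q x) (hQP : Q x + ‖x‖ ^ 2 * P x = 1)
    (hQP₁ : ‖x‖ ^ 2 * (σ + ‖x‖ ^ 2 * π + 2 * P x) = 0)
    (hW : 0 < 1 - H ^ 2 * ‖x‖ ^ 2) (hk : e x * κ x ^ 2 * (1 - H ^ 2 * ‖x‖ ^ 2) = H ^ 2)
    (hsign : 0 < κ x * H) (hβ : β = -2 * ψ₁ * e x) (hψ : 2 * Q x * ψ₁ = ((n : ℝ) - 1) * σ)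
    (hk₁ : k₁ = κ x * (ψ₁ + H ^ 2 / (1 - H ^ 2 * ‖x‖ ^ 2)))
    {N : EuclideanSpace ℝ (Fin n) × ℝ} (hN : IsUpwardUnitNormal g U x N) :
    meanCurvature g U N x = H := by
  have hgx : g (graphMap U x) = radialForm e Q P (graphMap U x) := hg.eq_of_nhds
  have hgd : fderiv ℝ g (graphMap U x) = fderiv ℝ (radialForm e Q P) (graphMap U x) :=
    hg.fderiv_eq
  have hN' : IsUpwardUnitNormal (radialForm e Q P) U x N := by
    obtain ⟨h1, h2, h3⟩ := hN
    rw [hgx] at h2 h3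
    exact ⟨fun v => by rw [← hgx]; exact h1 v, h2, h3⟩
  rw [isUpwardUnitNormal_radialForm_iff (hU x hx) he hQ hQP hk hsign] at hN'
  subst hN'
  have hxx : inner ℝ x x = ‖x‖ ^ 2 := real_inner_self_eq_norm_sq x
  have hk0 : κ x ≠ 0 := left_ne_zero_of_mul hsign.ne'
  have hm : e x * (H / (e x * κ x)) * κ x = H := by field_simp
  have h₁ : ∀ v w, firstFundamentalForm g U x v w =
      Q x * inner ℝ v w + (P x + e x * κ x ^ 2) * (inner ℝ x v * inner ℝ x w) := by
    intro v w
    unfold firstFundamentalForm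
    rw [hgx]
    simp only [radialForm_apply, fderiv_graphMap_apply (hU x hx), graphMap]
    ring
  have h₂ : ∀ v w, secondFundamentalForm g U (-H • x, H / (e x * κ x)) x v w =
      (H - H * ‖x‖ ^ 2 * (P x - σ / 2)) * inner ℝ v w +
      (e x * (H / (e x * κ x)) * k₁ + β * κ x * (H / (e x * κ x)) - H * σ - H * π * ‖x‖ ^ 2 / 2
        + β * H * ‖x‖ ^ 2 * κ x ^ 2 / 2) * (inner ℝ x v * inner ℝ x w) := by
    intro v w
    unfold secondFundamentalForm christoffel
    rw [hgx, hgd]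
    simp only [graphMap]
    simp only [fderiv_radialForm_apply hd hDe hDQ hDP]
    simp only [radialForm_apply, fderiv_graphMap_apply (hU x hx),
      fderiv_fderiv_graphMap_apply hΩ hUs hU hx hκ, inner_smul_left, inner_smul_right, hxx,
      conj_trivial, inner_zero_right, real_inner_comm x, real_inner_comm v w]
    linear_combination inner ℝ v w * hm
  set r2 := ‖x‖ ^ 2
  -- The radial eigenvalue of the first fundamental form is `1 + e κ² ‖x‖²`, and `hk` turns it into
  -- this.
  have hA1 : Q x + (P x + e x * κ x ^ 2) * r2 = 1 / (1 - H ^ 2 * r2) := by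
    rw [eq_div_iff hW.ne']
    linear_combination (1 - H ^ 2 * r2) * hQP + r2 * hk
  rw [meanCurvature_eq_of_rankOne h₁ h₂ hQ.ne' (by rw [hA1]; positivity), hA1]
  have hn' : (n : ℝ) ≠ 0 := by positivity
  -- Tangential part of the trace; `hψ` converts the derivative of `Q` into that of `ψ`, and it is
  -- here that the exponent `n - 1` of `ξ/r` matters.
  have hA2 : ((n : ℝ) - 1) * ((H - H * r2 * (P x - σ / 2)) / Q x) =
      H * ((n : ℝ) - 1 + ψ₁ * r2) := by
    rw [← mul_div_assoc, div_eq_iff hQ.ne']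
    linear_combination -(H * ((n : ℝ) - 1)) * hQP - H * r2 / 2 * hψ
  have hek : e x * (H / (e x * κ x)) * k₁ = H * (ψ₁ + H ^ 2 / (1 - H ^ 2 * r2)) := by
    rw [hk₁]
    linear_combination (ψ₁ + H ^ 2 / (1 - H ^ 2 * r2)) * hm
  have ht : e x * κ x ^ 2 = H ^ 2 / (1 - H ^ 2 * r2) := by
    rw [eq_div_iff hW.ne', hk]
  have htW : H ^ 2 / (1 - H ^ 2 * r2) * (1 - H ^ 2 * r2) = H ^ 2 := div_mul_cancel₀ _ hW.ne'
  rw [hA2, hek, hβ, div_div_eq_mul_div, div_one]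
  generalize H ^ 2 / (1 - H ^ 2 * r2) = t at ht htW
  -- The radial principal curvature is `H (1 - ψ₁ r²)`: its `ψ₁` term cancels the tangential one.
  have hrad : (H - H * r2 * (P x - σ / 2) + (H * (ψ₁ + t) +
      -2 * ψ₁ * e x * κ x * (H / (e x * κ x)) - H * σ - H * π * r2 / 2 +
      -2 * ψ₁ * e x * H * r2 * κ x ^ 2 / 2) * r2) * (1 - H ^ 2 * r2) = H * (1 - ψ₁ * r2) := by
    linear_combination (1 - H ^ 2 * r2) * (-2 * ψ₁ * r2 * hm - ψ₁ * H * r2 ^ 2 * ht - H / 2 * hQP₁)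
      + H * r2 * (1 - ψ₁ * r2) * htW
  rw [hrad]
  field_simp
  ring

end Graph

/-! ### Smoothness of `ψ` and of the warped metric. -/

variable {R : EReal} {ξ : ℝ → ℝ}

theorem exists_radius_of_mem_modelSpace {x : EuclideanSpace ℝ (Fin n)} (hx : x ∈ modelSpace n R) :
    ∃ a : ℝ, 0 < a ∧ (a : EReal) < R ∧ ‖x‖ < a := by
  obtain ⟨a, hxa, haR⟩ := EReal.lt_iff_exists_real_btwn.1 (show ((‖x‖ : ℝ) : EReal) < R from hx)
  rw [EReal.coe_lt_coe_iff] at hxa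
  exact ⟨a, (norm_nonneg x).trans_lt hxa, haR, hxa⟩

theorem IsModelWarping.contDiffOn_psi_norm (hξ : IsModelWarping R ξ) (c : ℝ) :
    ContDiffOn ℝ ∞ (fun x : EuclideanSpace ℝ (Fin n) => psi n c ξ ‖x‖) (modelSpace n R) := by
  intro x hx
  obtain ⟨a, ha, haR, hxa⟩ := exists_radius_of_mem_modelSpace hx
  obtain ⟨q, q₁, p, p₁, D⟩ := hξ.exists_evenData ha haR
  have hmem : Metric.closedBall (0 : EuclideanSpace ℝ (Fin n)) a ∈ 𝓝 x :=
    Metric.isOpen_ball.mem_nhds (mem_ball_zero_iff.2 hxa) |> mem_of_superset <|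
      Metric.ball_subset_closedBall
  refine ContDiffAt.contDiffWithinAt ?_
  refine ((D.contDiffOn_evenPsi_norm n c n).contDiffAt hmem).congr_of_eventuallyEq ?_
  filter_upwards [hmem] with y hy
  exact D.psi_eq n c ⟨norm_nonneg y, mem_closedBall_zero_iff.1 hy⟩

namespace EvenData

variable {a : ℝ} {q q₁ p p₁ : ℝ → ℝ}

theorem contDiffOn_radialForm (D : EvenData ξ a q q₁ p p₁) (c : ℝ) :
    ContDiffOn ℝ ∞ (radialForm (fun x : EuclideanSpace ℝ (Fin n) =>
      Real.exp (-2 * evenPsi n c q ‖x‖)) (fun x => q ‖x‖ ^ 2) (fun x => p ‖x‖))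
      (Metric.ball 0 a ×ˢ univ) := by
  refine KillingGraph.contDiffOn_radialForm ?_ ?_ ?_
  · exact (contDiffOn_const.mul
      ((D.contDiffOn_evenPsi_norm n c n).mono Metric.ball_subset_closedBall)).exp
  · exact ((contDiff_comp_norm_of_even D.smooth_q D.even_q).pow 2).contDiffOn
  · exact (contDiff_comp_norm_of_even D.smooth_p D.even_p).contDiffOn

theorem contDiffAt_radialForm (D : EvenData ξ a q q₁ p p₁) (c : ℝ)
    {y : EuclideanSpace ℝ (Fin n) × ℝ} (hy : ‖y.1‖ < a) :
    ContDiffAt ℝ ∞ (radialForm (fun x : EuclideanSpace ℝ (Fin n) =>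
      Real.exp (-2 * evenPsi n c q ‖x‖)) (fun x => q ‖x‖ ^ 2) (fun x => p ‖x‖)) y := by
  have hmem : Metric.ball (0 : EuclideanSpace ℝ (Fin n)) a ×ˢ (univ : Set ℝ) ∈ 𝓝 y :=
    (Metric.isOpen_ball.prod isOpen_univ).mem_nhds ⟨mem_ball_zero_iff.2 hy, mem_univ _⟩
  exact (D.contDiffOn_radialForm c).contDiffAt hmem

theorem differentiableAt_radialForm (D : EvenData ξ a q q₁ p p₁) (c : ℝ)
    {y : EuclideanSpace ℝ (Fin n) × ℝ} (hy : ‖y.1‖ < a) :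
    DifferentiableAt ℝ (radialForm (fun x : EuclideanSpace ℝ (Fin n) =>
      Real.exp (-2 * evenPsi n c q ‖x‖)) (fun x => q ‖x‖ ^ 2) (fun x => p ‖x‖)) y :=
  (D.contDiffAt_radialForm c hy).differentiableAt (by simp)

theorem warpedMetric_eventuallyEq (D : EvenData ξ a q q₁ p p₁) (c : ℝ)
    {y : EuclideanSpace ℝ (Fin n) × ℝ} (hy : ‖y.1‖ < a) :
    warpedMetric ξ (psi n c ξ) =ᶠ[𝓝 y] radialForm (fun x : EuclideanSpace ℝ (Fin n) =>
      Real.exp (-2 * evenPsi n c q ‖x‖)) (fun x => q ‖x‖ ^ 2) (fun x => p ‖x‖) := by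
  have hmem : Metric.ball (0 : EuclideanSpace ℝ (Fin n)) a ×ˢ (univ : Set ℝ) ∈ 𝓝 y :=
    (Metric.isOpen_ball.prod isOpen_univ).mem_nhds ⟨mem_ball_zero_iff.2 hy, mem_univ _⟩
  filter_upwards [hmem] with z hz
  exact D.warpedMetric_eq (fun r hr => D.psi_eq n c hr) (mem_ball_zero_iff.1 hz.1).le

end EvenData

theorem IsModelWarping.isRiemannianMetricOn_warpedMetric (hξ : IsModelWarping R ξ) (c : ℝ) :
    IsRiemannianMetricOn (warpedMetric (n := n) ξ (psi n c ξ)) (modelSpace n R ×ˢ univ) := by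
  refine ⟨fun y hy => ?_, fun y hy V W => ?_, fun y hy V hV => ?_⟩
  all_goals
    obtain ⟨a, ha, haR, hya⟩ := exists_radius_of_mem_modelSpace hy.1
    obtain ⟨q, q₁, p, p₁, D⟩ := hξ.exists_evenData ha haR
    have heq := D.warpedMetric_eventuallyEq c hya
  · refine ContDiffAt.contDiffWithinAt (ContDiffAt.congr_of_eventuallyEq ?_ heq)
    exact D.contDiffAt_radialForm c hya
  · rw [heq.eq_of_nhds, radialForm_symm]
  · rw [heq.eq_of_nhds]
    refine radialForm_pos (Real.exp_pos _) (pow_pos (D.q_pos _ ?_) 2) ?_ hV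
    · rw [abs_of_nonneg (norm_nonneg _)]; exact hya.le
    · rw [D.sq_add]; exact one_pos

/-! ### The graph of the profile over the ball. -/

section SphericalGraph

variable {r₀ H₀ c : ℝ} {q q₁ p p₁ : ℝ → ℝ}

/-- The quotient `u'(r) / r` for the profile `u`. -/
noncomputable def slope (φ : ℝ → ℝ) (H₀ r : ℝ) : ℝ :=
  H₀ / Real.sqrt (1 - H₀ ^ 2 * r ^ 2) * Real.exp (φ r)

theorem hasDerivAt_slope {φ : ℝ → ℝ} {r ψ₁ : ℝ} (hr : 0 < 1 - H₀ ^ 2 * r ^ 2)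
    (hφ : HasDerivAt φ (r * ψ₁) r) :
    HasDerivAt (slope φ H₀) (r * (slope φ H₀ r * (ψ₁ + H₀ ^ 2 / (1 - H₀ ^ 2 * r ^ 2)))) r := by
  have hs := Real.sqrt_pos.2 hr
  refine ((((hasDerivAt_const r H₀).div (hasDerivAt_sqrt_one_sub hr) hs.ne')).mul
    hφ.exp).congr_deriv ?_
  have hsq := Real.sq_sqrt hr.le
  simp only [slope, Pi.div_apply]
  generalize Real.sqrt (1 - H₀ ^ 2 * r ^ 2) = s at hs hsq
  rw [← hsq]
  field_simp
  ring

/-- This identity is the relation that the normal and mean curvature computations require of the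
slope, with `e = e^{-2φ}`. -/
theorem slope_sq {φ : ℝ → ℝ} {r : ℝ} (hr : 0 < 1 - H₀ ^ 2 * r ^ 2) :
    Real.exp (-2 * φ r) * slope φ H₀ r ^ 2 * (1 - H₀ ^ 2 * r ^ 2) = H₀ ^ 2 := by
  unfold slope
  have he : Real.exp (-2 * φ r) * Real.exp (φ r) ^ 2 = 1 := by
    rw [← Real.exp_nat_mul, ← Real.exp_add, Real.exp_eq_one_iff]
    push_cast
    ring
  rw [mul_pow, div_pow, Real.sq_sqrt hr.le]
  generalize Real.exp (-2 * φ r) = y at he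
  field_simp
  linear_combination H₀ ^ 2 * he

theorem EvenData.hasFDerivAt_profile_norm (D : EvenData ξ r₀ q q₁ p p₁) (hr₀ : 0 < r₀)
    (hH₀ : H₀ = -1 / r₀) {x : EuclideanSpace ℝ (Fin n)} (hx : x ∈ Metric.ball 0 r₀) :
    HasFDerivAt (fun x : EuclideanSpace ℝ (Fin n) => profile (psi n c ξ) H₀ r₀ ‖x‖)
      (slope (evenPsi n c q) H₀ ‖x‖ • innerSL ℝ x) x := by
  have hφ : ContinuousOn (evenPsi n c q) (Icc (-r₀) r₀) := fun r hr =>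
    (D.hasDerivAt_evenPsi n c (abs_le.2 hr)).continuousAt.continuousWithinAt
  have h1 := hasDerivAt_profile hr₀ hH₀ hφ (norm_nonneg x) (mem_ball_zero_iff.1 hx)
  have h2 := hasFDerivAt_comp_norm (x := x) (f := profile (evenPsi n c q) H₀ r₀)
    (h1.congr_deriv (show _ = ‖x‖ * slope (evenPsi n c q) H₀ ‖x‖ by
      unfold profileDensity slope; ring))
  refine h2.congr_of_eventuallyEq ?_
  filter_upwards [Metric.isOpen_ball.mem_nhds hx] with y hy
  exact profile_congr (fun r hr => D.psi_eq n c hr) ⟨norm_nonneg y, (mem_ball_zero_iff.1 hy).le⟩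

/-- Smoothness is read off the gradient `slope(‖x‖) x`, whose factors are explicit; the integral
itself is never differentiated more than once. -/
theorem EvenData.contDiffOn_profile_norm (D : EvenData ξ r₀ q q₁ p p₁) (hr₀ : 0 < r₀)
    (hH₀ : H₀ = -1 / r₀) :
    ContDiffOn ℝ ∞ (fun x : EuclideanSpace ℝ (Fin n) => profile (psi n c ξ) H₀ r₀ ‖x‖)
      (Metric.ball 0 r₀) := by
  have hd := fun (x : EuclideanSpace ℝ (Fin n)) (hx : x ∈ Metric.ball 0 r₀) =>
    D.hasFDerivAt_profile_norm (c := c) hr₀ hH₀ hx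
  rw [contDiffOn_infty_iff_fderiv_of_isOpen Metric.isOpen_ball]
  refine ⟨fun x hx => (hd x hx).differentiableAt.differentiableWithinAt, ?_⟩
  refine ContDiffOn.congr ?_ fun x hx => (hd x hx).fderiv
  have hpos : ∀ x ∈ Metric.ball (0 : EuclideanSpace ℝ (Fin n)) r₀,
      0 < 1 - H₀ ^ 2 * ‖x‖ ^ 2 := fun x hx =>
    one_sub_sq_pos hr₀ hH₀ (by rw [abs_of_nonneg (norm_nonneg x)]; exact mem_ball_zero_iff.1 hx)
  have hin : ContDiff ℝ ∞ fun x : EuclideanSpace ℝ (Fin n) => innerSL ℝ x := (innerSL ℝ).contDiff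
  have hsl : ContDiffOn ℝ ∞ (fun x : EuclideanSpace ℝ (Fin n) => slope (evenPsi n c q) H₀ ‖x‖)
      (Metric.ball 0 r₀) := by
    refine ContDiffOn.mul (contDiffOn_const.div (ContDiffOn.sqrt ?_ fun x hx => (hpos x hx).ne')
      fun x hx => (Real.sqrt_pos.2 (hpos x hx)).ne') ?_
    · have hns : ContDiff ℝ ∞ fun x : EuclideanSpace ℝ (Fin n) => ‖x‖ ^ 2 := contDiff_norm_sq ℝ
      exact (contDiff_const.sub (contDiff_const.mul hns)).contDiffOn
    · exact ((D.contDiffOn_evenPsi_norm n c n).mono Metric.ball_subset_closedBall).exp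
  exact hsl.smul hin.contDiffOn

theorem EvenData.isCMCGraph (hn : 1 ≤ n) (D : EvenData ξ r₀ q q₁ p p₁) (hr₀ : 0 < r₀)
    (hH₀ : H₀ = -1 / r₀) :
    IsCMCGraph (warpedMetric (n := n) ξ (psi n c ξ))
      (fun x : EuclideanSpace ℝ (Fin n) => profile (psi n c ξ) H₀ r₀ ‖x‖)
      (Metric.ball 0 r₀) H₀ := by
  have hU := fun (x : EuclideanSpace ℝ (Fin n)) (hx : x ∈ Metric.ball 0 r₀) =>
    D.hasFDerivAt_profile_norm (c := c) hr₀ hH₀ hx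
  have hlt : ∀ x ∈ Metric.ball (0 : EuclideanSpace ℝ (Fin n)) r₀, |‖x‖| < r₀ := fun x hx => by
    rw [abs_of_nonneg (norm_nonneg x)]; exact mem_ball_zero_iff.1 hx
  have hpos : ∀ x ∈ Metric.ball (0 : EuclideanSpace ℝ (Fin n)) r₀,
      0 < 1 - H₀ ^ 2 * ‖x‖ ^ 2 := fun x hx => one_sub_sq_pos hr₀ hH₀ (hlt x hx)
  have hH : H₀ ≠ 0 := by rw [hH₀]; exact div_ne_zero (by norm_num) hr₀.ne'
  have hsign : ∀ x ∈ Metric.ball (0 : EuclideanSpace ℝ (Fin n)) r₀,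
      0 < slope (evenPsi n c q) H₀ ‖x‖ * H₀ := by
    intro x hx
    have := Real.sqrt_pos.2 (hpos x hx)
    have h2 : slope (evenPsi n c q) H₀ ‖x‖ * H₀ = H₀ ^ 2 / Real.sqrt (1 - H₀ ^ 2 * ‖x‖ ^ 2) *
        Real.exp (evenPsi n c q ‖x‖) := by
      unfold slope; ring
    rw [h2]
    positivity
  refine ⟨D.contDiffOn_profile_norm hr₀ hH₀, fun x hx => ?_, fun x hx N hN => ?_⟩
  all_goals
    have heq : warpedMetric ξ (psi n c ξ) =ᶠ[𝓝 (x, profile (psi n c ξ) H₀ r₀ ‖x‖)] _ :=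
      D.warpedMetric_eventuallyEq c (mem_ball_zero_iff.1 hx)
    have hQ : 0 < q ‖x‖ ^ 2 := pow_pos (D.q_pos _ (hlt x hx).le) 2
  · refine ⟨(-H₀ • x, H₀ / (Real.exp (-2 * evenPsi n c q ‖x‖) * slope (evenPsi n c q) H₀ ‖x‖)), ?_⟩
    have h := (isUpwardUnitNormal_radialForm_iff (P := fun x => p ‖x‖) (Q := fun x => q ‖x‖ ^ 2)
      (e := fun x => Real.exp (-2 * evenPsi n c q ‖x‖)) (hU x hx) (Real.exp_pos _) hQ
      (D.sq_add _) (slope_sq (hpos x hx)) (hsign x hx) _).2 rfl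
    obtain ⟨h1, h2, h3⟩ := h
    have hgx := heq.eq_of_nhds
    simp only [graphMap] at h1 h2 h3
    rw [← hgx] at h2 h3
    exact ⟨fun v => by simp only [graphMap]; rw [hgx]; exact h1 v, h2, h3⟩
  · have hψ₁ := D.hasDerivAt_evenPsi n c (hlt x hx).le
    have hDe : HasDerivAt (fun r => Real.exp (-2 * evenPsi n c q r))
        (‖x‖ * (-2 * (((n : ℝ) - 1) * q₁ ‖x‖ / q ‖x‖) * Real.exp (-2 * evenPsi n c q ‖x‖))) ‖x‖ :=
      (hψ₁.const_mul (-2)).exp.congr_deriv (by ring)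
    have hDQ : HasDerivAt (fun r => q r ^ 2) (‖x‖ * (2 * q ‖x‖ * q₁ ‖x‖)) ‖x‖ :=
      ((D.deriv_q ‖x‖).pow 2).congr_deriv (by push_cast; ring)
    have hdiff := D.differentiableAt_radialForm c
      (y := (x, profile (psi n c ξ) H₀ r₀ ‖x‖)) (mem_ball_zero_iff.1 hx)
    have hκ := hasFDerivAt_comp_norm (hasDerivAt_slope (hpos x hx) hψ₁)
    have hDe' := hasFDerivAt_comp_norm hDe
    have hDQ' := hasFDerivAt_comp_norm hDQ
    have hDP' := hasFDerivAt_comp_norm (D.deriv_p ‖x‖)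
    refine meanCurvature_radialForm (ψ₁ := ((n : ℝ) - 1) * q₁ ‖x‖ / q ‖x‖) hn heq hdiff
      Metric.isOpen_ball (D.contDiffOn_profile_norm hr₀ hH₀) hU hx hκ hDe' hDQ' hDP'
      (Real.exp_pos _) hQ (D.sq_add _) (D.deriv_sq_add _) (hpos x hx) (slope_sq (hpos x hx))
      (hsign x hx) rfl ?_ rfl hN
    · have := (D.q_pos _ (hlt x hx).le).ne'
      field_simp

end SphericalGraph

/-! ### Extrema over the ball and the main theorem. -/

theorem image_norm_ball (hn : 1 ≤ n) (ψ : ℝ → ℝ) (r₀ : ℝ) :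
    (fun x : EuclideanSpace ℝ (Fin n) => ψ ‖x‖) '' Metric.ball 0 r₀ = ψ '' Ico 0 r₀ := by
  ext y
  constructor
  · rintro ⟨x, hx, rfl⟩
    exact ⟨‖x‖, ⟨norm_nonneg x, mem_ball_zero_iff.1 hx⟩, rfl⟩
  · rintro ⟨r, hr, rfl⟩
    have hx : ‖r • EuclideanSpace.single (⟨0, hn⟩ : Fin n) (1 : ℝ)‖ = r := by
      rw [norm_smul, PiLp.norm_single, Real.norm_of_nonneg hr.1]
      simp
    exact ⟨_, mem_ball_zero_iff.2 (hx.trans_lt hr.2), by simp only [hx]⟩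

/-- The extremum may be attained at the excluded endpoint `r₀`; continuity and the density of `[0,
r₀)` in `[0, r₀]` still give the same supremum. -/
theorem isLUB_image_Ico {ψ : ℝ → ℝ} {r₀ : ℝ} (hr₀ : 0 < r₀) (hψ : ContinuousOn ψ (Icc 0 r₀))
    {t : ℝ} (ht : t ∈ Icc 0 r₀) (hmax : ∀ r ∈ Icc 0 r₀, ψ r ≤ ψ t) :
    IsLUB (ψ '' Ico 0 r₀) (ψ t) := by
  refine ⟨?_, fun B hB => ?_⟩
  · rintro _ ⟨r, hr, rfl⟩
    exact hmax r (Ico_subset_Icc_self hr)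
  · have hcl := closure_Ico hr₀.ne
    refine le_on_closure (s := Ico 0 r₀) (f := ψ) (g := fun _ => B)
      (fun r hr => hB ⟨r, hr, rfl⟩) (by rwa [hcl]) continuousOn_const (by rwa [hcl])

theorem isGLB_image_Ico {ψ : ℝ → ℝ} {r₀ : ℝ} (hr₀ : 0 < r₀) (hψ : ContinuousOn ψ (Icc 0 r₀))
    {t : ℝ} (ht : t ∈ Icc 0 r₀) (hmin : ∀ r ∈ Icc 0 r₀, ψ t ≤ ψ r) :
    IsGLB (ψ '' Ico 0 r₀) (ψ t) := by
  refine ⟨?_, fun B hB => ?_⟩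
  · rintro _ ⟨r, hr, rfl⟩
    exact hmin r (Ico_subset_Icc_self hr)
  · have hcl := closure_Ico hr₀.ne
    refine le_on_closure (s := Ico 0 r₀) (g := ψ) (f := fun _ => B)
      (fun r hr => hB ⟨r, hr, rfl⟩) continuousOn_const (by rwa [hcl]) (by rwa [hcl])

end KillingGraph

theorem mainTheorem12 (n : ℕ) (hn : 1 ≤ n) (R : EReal) (ξ : ℝ → ℝ)
    (hξ : KillingGraph.IsModelWarping R ξ) (c : ℝ) (hc : 0 < c)
    (r₀ : ℝ) (hr₀ : 0 < r₀) (hr₀R : (r₀ : EReal) < R)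
    (ψ : ℝ → ℝ) (hψ : ψ = KillingGraph.psi n c ξ)
    (H₀ : ℝ) (hH₀ : H₀ = -1 / r₀)
    (u : ℝ → ℝ) (hu : u = KillingGraph.profile ψ H₀ r₀) :
    -- `ψ` is a smooth function on `P`, and `M` is a smooth Riemannian manifold
    ContDiffOn ℝ ∞ (fun x : EuclideanSpace ℝ (Fin n) => ψ ‖x‖) (KillingGraph.modelSpace n R) ∧
    KillingGraph.IsRiemannianMetricOn (KillingGraph.warpedMetric (n := n) ξ ψ)
      (KillingGraph.modelSpace n R ×ˢ Set.univ) ∧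
    -- the improper integral that defines `u` converges absolutely
    IntervalIntegrable (KillingGraph.profileDensity ψ H₀) MeasureTheory.volume 0 r₀ ∧
    -- the Killing graph of `u` over the ball of radius `r₀` has constant mean curvature `H₀`
    KillingGraph.IsCMCGraph (KillingGraph.warpedMetric (n := n) ξ ψ)
      (fun x : EuclideanSpace ℝ (Fin n) => u ‖x‖)
      (Metric.ball (0 : EuclideanSpace ℝ (Fin n)) r₀) H₀ ∧
    -- the height estimate, with `a = max e^{-ψ}`, `b = min e^{-ψ}` over `[0, r₀]` and `S = sup ψ`,
    -- `I = inf ψ` over the ball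
    ∃ a b S I : ℝ,
      IsGreatest ((fun t => Real.exp (-ψ t)) '' Set.Icc 0 r₀) a ∧
      IsLeast ((fun t => Real.exp (-ψ t)) '' Set.Icc 0 r₀) b ∧
      IsLUB ((fun x : EuclideanSpace ℝ (Fin n) => ψ ‖x‖) '' Metric.ball 0 r₀) S ∧
      IsGLB ((fun x : EuclideanSpace ℝ (Fin n) => ψ ‖x‖) '' Metric.ball 0 r₀) I ∧
      a / b * (1 / |H₀|) = Real.exp (S - I) * (1 / |H₀|) ∧
      ∀ r ∈ Set.Icc 0 r₀,
        0 ≤ Real.exp (-ψ r) * u r ∧ Real.exp (-ψ r) * u r ≤ a / b * (1 / |H₀|) := by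
  obtain ⟨q, q₁, p, p₁, D⟩ := hξ.exists_evenData hr₀ hr₀R
  have hcont : ContinuousOn ψ (Icc 0 r₀) := by
    intro r hr
    have h1 := (D.hasDerivAt_evenPsi n c (r := r) (by rw [abs_of_nonneg hr.1]; exact hr.2))
    refine h1.continuousAt.continuousWithinAt.congr (fun s hs => ?_) ?_
    · rw [hψ, D.psi_eq n c hs]
    · rw [hψ, D.psi_eq n c hr]
  have hne : (Icc (0 : ℝ) r₀).Nonempty := nonempty_Icc.2 hr₀.le
  obtain ⟨s, hs, hmax⟩ := isCompact_Icc.exists_isMaxOn hne hcont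
  obtain ⟨t, ht, hmin⟩ := isCompact_Icc.exists_isMinOn hne hcont
  have hmax' : ∀ r ∈ Icc 0 r₀, ψ r ≤ ψ s := fun r hr => hmax hr
  have hmin' : ∀ r ∈ Icc 0 r₀, ψ t ≤ ψ r := fun r hr => hmin hr
  -- Since `e^{-ψ}` reverses order, its maximum is taken at the minimum point `t` of `ψ` and its
  -- minimum at the maximum point `s`.
  refine ⟨hψ ▸ hξ.contDiffOn_psi_norm c, hψ ▸ hξ.isRiemannianMetricOn_warpedMetric c,
    KillingGraph.intervalIntegrable_profileDensity hr₀ hH₀ hcont, ?_,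
    Real.exp (-ψ t), Real.exp (-ψ s), ψ s, ψ t, ⟨⟨t, ht, rfl⟩, ?_⟩, ⟨⟨s, hs, rfl⟩, ?_⟩, ?_, ?_, ?_,
    fun r hr => ?_⟩
  · rw [hu, hψ]
    exact D.isCMCGraph hn hr₀ hH₀
  · rintro _ ⟨r, hr, rfl⟩
    exact Real.exp_le_exp.2 (neg_le_neg (hmin' r hr))
  · rintro _ ⟨r, hr, rfl⟩
    exact Real.exp_le_exp.2 (neg_le_neg (hmax' r hr))
  · rw [KillingGraph.image_norm_ball hn]
    exact KillingGraph.isLUB_image_Ico hr₀ hcont hs hmax'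
  · rw [KillingGraph.image_norm_ball hn]
    exact KillingGraph.isGLB_image_Ico hr₀ hcont ht hmin'
  · rw [← Real.exp_sub]
    congr 2
    ring
  · obtain ⟨h0, h1⟩ := KillingGraph.profile_nonneg_and_le hr₀ hH₀ hcont hmax' hr
    rw [← hu] at h0 h1
    refine ⟨mul_nonneg (Real.exp_pos _).le h0, ?_⟩
    have hH : 1 / |H₀| = r₀ := by
      rw [hH₀, abs_div, abs_neg, abs_one, abs_of_pos hr₀, one_div_one_div]
    have hab : Real.exp (-ψ t) / Real.exp (-ψ s) = Real.exp (-ψ t) * Real.exp (ψ s) := by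
      rw [Real.exp_neg (ψ s), div_inv_eq_mul]
    rw [hH, hab, mul_assoc]
    -- The two factors are bounded separately: `e^{-ψ(r)} ≤ e^{-ψ(t)}` and `u(r) ≤ e^{ψ(s)} r₀`.
    exact mul_le_mul (Real.exp_le_exp.2 (neg_le_neg (hmin' r hr))) h1 h0 (Real.exp_pos _).le
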